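/- Let $(\Omega,\mathcal F,\mathbb P)$ be a nonatomic probability space, $L^1$ the space of integrable random variables modulo a.s. equality, $\mathcal L\subset L^1$ the space of simple random variables, and $\Pi$ the collection of finite measurable partitions $\pi$ of $\Omega$ whose members have non-zero probability; write $\mathbb E[X|\pi]=\mathbb E[X|\sigma(\pi)]$. Let $\sigma(L^1,\mathcal L)$ be the coarsest topology on $L^1$ making $X\mapsto\mathbb E[XY]$ continuous for every $Y\in\mathcal L$. An ideal of $L^1$ is a linear subspace $I$ such that $|X|\le|Y|$, $Y\in I$, $X\in L^1$ imply $X\in I$; $\mathcal I(\mathcal S)$ denotes the smallest ideal including $\mathcal S\subset L^1$. For $\mathcal L\subset\mathcal X\subset L^1$, a functional $\rho:\mathcal X\to(-\infty,\infty]$ is called: - dilatation monotone if $\rho(\mathbb E[X|\pi])\le\rho(X)$ for all $X\in\mathcal X$, $\pi\in\Pi$; - law-invariant if $\rho(X)=\rho(Y)$ whenever $X,Y\in\mathcal X$ have the same distribution; - monotone if $\rho(X)\le\rho(Y)$ whenever $X,Y\in\mathcal X$ and $X\ge Y$; - convex (resp. quasiconvex) if $\rho(\lambda X+(1-\lambda)Y)\le\lambda\rho(X)+(1-\lambda)\rho(Y)$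 (resp. $\le\max\{\rho(X),\rho(Y)\}$) whenever $X,Y\in\mathcal X$, $\lambda\in(0,1)$ and $\lambda X+(1-\lambda)Y\in\mathcal X$; - cash-additive if $\rho(X+s)=\rho(X)-s$ whenever $X\in\mathcal X$, $s\in\mathbb R$ and $X+s\in\mathcal X$. It has the Fatou property if, for every sequence $(X_n)_{n\in\mathbb N}$ in $\mathcal X$ and every $X\in\mathcal X$ with $X_n\to X$ a.s. and $\sup_n|X_n|\in\mathcal I(\mathcal X)$, one has $\rho(X)\le\liminf_n\rho(X_n)$. A functional on $L^1$ is $\sigma(L^1,\mathcal L)$ lower semicontinuous if its sublevel sets $\{\rho\le\lambda\}$, $\lambda\in\mathbb R$, are $\sigma(L^1,\mathcal L)$-closed. **Theorem.** Let $\mathcal X\subset L^1$ contain $\mathcal L$, let $\rho:\mathcal X\to(-\infty,\infty]$ be dilatation monotone with the Fatou property, and put $$\overline\rho(X)=\sup_{\pi\in\Pi}\rho(\mathbb E[X|\pi]),\qquad X\in L^1.$$ Then $\overline\rho$ takes values in $(-\infty,\infty]$, agrees with $\rho$ on $\mathcal X$, is dilatation monotone and $\sigma(L^1,\mathcal L)$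 lower semicontinuous, and is the only functional on $L^1$ (even among those with values in $[-\infty,\infty]$) that agrees with $\rho$ on $\mathcal X$ and is dilatation monotone and $\sigma(L^1,\mathcal L)$ lower semicontinuous. Moreover, $\overline\rho$ is law-invariant, and if $\rho$ is monotone (resp. convex, quasiconvex, cash-additive), then so is $\overline\rho$. -/

import Mathlib

open MeasureTheory ProbabilityTheory Filter Topology

noncomputable section

namespace DilatationMonotone

/-- `P` is nonatomic: every measurable set of positive measure has a measurable subset of
strictly smaller positive measure. (Vanishing on singletons, which is what Mathlib's
`NullSingletonClass` says, is weaker in general.) -/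
def Nonatomic {Ω : Type*} [MeasurableSpace Ω] (P : Measure Ω) : Prop :=
  ∀ A : Set Ω, MeasurableSet A → 0 < P A →
    ∃ B : Set Ω, B ⊆ A ∧ MeasurableSet B ∧ 0 < P B ∧ P B < P A

/-- The finite measurable partitions of `Ω` all of whose members have non-zero probability. -/
structure Partition {Ω : Type*} [MeasurableSpace Ω] (P : Measure Ω) where
  parts : Finset (Set Ω)
  measurableSet : ∀ A ∈ parts, MeasurableSet A
  measure_ne_zero : ∀ A ∈ parts, P A ≠ 0
  pairwiseDisjoint : (parts : Set (Set Ω)).PairwiseDisjoint id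
  sUnion_eq : ⋃₀ (parts : Set (Set Ω)) = Set.univ

/-- The finite `σ`-algebra generated by a partition. -/
abbrev Partition.sigma {Ω : Type*} [MeasurableSpace Ω] {P : Measure Ω} (π : Partition P) :
    MeasurableSpace Ω :=
  MeasurableSpace.generateFrom (π.parts : Set (Set Ω))

theorem Partition.sigma_le {Ω : Type*} [mΩ : MeasurableSpace Ω] {P : Measure Ω}
    (π : Partition P) : π.sigma ≤ mΩ :=
  MeasurableSpace.generateFrom_le fun A hA => π.measurableSet A hA

/-- The conditional expectation `𝔼[X | π]`, as an element of `L¹`. -/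
def condE {Ω : Type*} [MeasurableSpace Ω] {P : Measure Ω} (π : Partition P)
    (X : Lp ℝ 1 P) : Lp ℝ 1 P :=
  (integrable_condExp (μ := P) (m := π.sigma) (f := (X : Ω → ℝ))).toL1

/-- The simple random variables, as a subset of `L¹`. -/
def simpleRV {Ω : Type*} [MeasurableSpace Ω] (P : Measure Ω) : Set (Lp ℝ 1 P) :=
  (Lp.simpleFunc ℝ 1 P : Set (Lp ℝ 1 P))

/-- `𝔼[X | π]` is a simple random variable. In particular it lies in every domain that contains
the simple random variables. -/
theorem condE_mem_simpleRV {Ω : Type*} [MeasurableSpace Ω] {P : Measure Ω}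
    (π : Partition P) (X : Lp ℝ 1 P) : condE π X ∈ simpleRV P := by
  classical
  set f : Ω → ℝ := P[(X : Ω → ℝ) | π.sigma] with hf
  have hfm : Measurable[π.sigma] f := stronglyMeasurable_condExp.measurable
  have key : ∀ s : Set Ω, MeasurableSet[π.sigma] s → ∀ A ∈ π.parts, ∀ x ∈ A, ∀ y ∈ A,
      (x ∈ s ↔ y ∈ s) := by
    intro s hs A hA x hx y hy
    induction s, hs using MeasurableSpace.generateFrom_induction with
    | hC t ht _ =>
      by_cases h : t = A
      · subst h; simp [hx, hy]
      · have hd : Disjoint t A := π.pairwiseDisjoint ht hA h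
        exact ⟨fun hxt => (Set.disjoint_left.1 hd hxt hx).elim,
          fun hyt => (Set.disjoint_left.1 hd hyt hy).elim⟩
    | empty => simp
    | compl t _ ih => simp [ih]
    | iUnion g _ ih => simp only [Set.mem_iUnion]; exact exists_congr ih
  have hconst : ∀ A ∈ π.parts, ∀ x ∈ A, ∀ y ∈ A, f x = f y := by
    intro A hA x hx y hy
    have := (key _ (hfm (measurableSet_singleton (f x))) A hA x hx y hy).1 rfl
    exact (Set.mem_singleton_iff.1 this).symm
  have hfin : (Set.range f).Finite := by
    have : Set.range f ⊆ ⋃ A ∈ π.parts, f '' A := by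
      rintro _ ⟨x, rfl⟩
      have hx : x ∈ ⋃₀ (π.parts : Set (Set Ω)) := π.sUnion_eq ▸ Set.mem_univ x
      obtain ⟨A, hA, hxA⟩ := hx
      exact Set.mem_biUnion (Finset.mem_coe.1 hA) ⟨x, hxA, rfl⟩
    refine Set.Finite.subset (Set.Finite.biUnion π.parts.finite_toSet ?_) this
    intro A hA
    refine Set.Subsingleton.finite ?_
    rintro _ ⟨x, hx, rfl⟩ _ ⟨y, hy, rfl⟩
    exact hconst A hA x hx y hy
  refine ⟨⟨f, fun r => (hfm.mono π.sigma_le le_rfl) (measurableSet_singleton r), hfin⟩, ?_⟩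
  rfl

/-- The weak topology `σ(L¹, 𝓛)`: the coarsest topology on `L¹` for which `X ↦ 𝔼[X Y]` is
continuous for every simple random variable `Y`. -/
abbrev weakTopology {Ω : Type*} [MeasurableSpace Ω] (P : Measure Ω) :
    TopologicalSpace (Lp ℝ 1 P) :=
  ⨅ Y : simpleRV P, TopologicalSpace.induced
    (fun X : Lp ℝ 1 P => ∫ ω, X ω * (Y : Lp ℝ 1 P) ω ∂P) inferInstance

/-- An ideal of `L¹` is a solid linear subspace. -/
def IsSolid {Ω : Type*} [MeasurableSpace Ω] {P : Measure Ω}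
    (I : Submodule ℝ (Lp ℝ 1 P)) : Prop :=
  ∀ X Y : Lp ℝ 1 P, |X| ≤ |Y| → Y ∈ I → X ∈ I

/-- The smallest ideal of `L¹` that includes `S`. -/
def solidSpan {Ω : Type*} [MeasurableSpace Ω] {P : Measure Ω} (S : Set (Lp ℝ 1 P)) :
    Submodule ℝ (Lp ℝ 1 P) :=
  sInf {I : Submodule ℝ (Lp ℝ 1 P) | S ⊆ I ∧ IsSolid I}

/-! ### Properties of a functional `ρ` on a domain `𝒳 ⊆ L¹`

A functional on `𝒳` is given by a map on `L¹` whose values outside `𝒳` are irrelevant: for a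
domain that contains the simple random variables, no property below depends on them. The value
`⊤` is `∞`. -/

/-- `ρ` takes values in `(-∞, ∞]` on `𝒳`. -/
def IsProperOn {Ω : Type*} [MeasurableSpace Ω] {P : Measure Ω}
    (𝒳 : Set (Lp ℝ 1 P)) (ρ : Lp ℝ 1 P → EReal) : Prop :=
  ∀ X ∈ 𝒳, ρ X ≠ ⊥

def IsDilatationMonotoneOn {Ω : Type*} [MeasurableSpace Ω] {P : Measure Ω}
    (𝒳 : Set (Lp ℝ 1 P)) (ρ : Lp ℝ 1 P → EReal) : Prop :=
  ∀ X ∈ 𝒳, ∀ π : Partition P, ρ (condE π X) ≤ ρ X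

/-- The Fatou property. The element `S` is `sup_n |X_n|`. -/
def HasFatouPropertyOn {Ω : Type*} [MeasurableSpace Ω] {P : Measure Ω}
    (𝒳 : Set (Lp ℝ 1 P)) (ρ : Lp ℝ 1 P → EReal) : Prop :=
  ∀ (X : ℕ → Lp ℝ 1 P) (Z : Lp ℝ 1 P), (∀ n, X n ∈ 𝒳) → Z ∈ 𝒳 →
    (∀ᵐ ω ∂P, Tendsto (fun n => X n ω) atTop (𝓝 (Z ω))) →
    (∃ S ∈ solidSpan 𝒳, ∀ᵐ ω ∂P, IsLUB (Set.range fun n => |X n ω|) (S ω)) →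
    ρ Z ≤ liminf (fun n => ρ (X n)) atTop

def IsLawInvariantOn {Ω : Type*} [MeasurableSpace Ω] {P : Measure Ω}
    (𝒳 : Set (Lp ℝ 1 P)) (ρ : Lp ℝ 1 P → EReal) : Prop :=
  ∀ X ∈ 𝒳, ∀ Y ∈ 𝒳, IdentDistrib (X : Ω → ℝ) (Y : Ω → ℝ) P P → ρ X = ρ Y

/-- Monotonicity in the sense of risk measures: `X ≥ Y` implies `ρ X ≤ ρ Y`. -/
def IsMonotoneOn {Ω : Type*} [MeasurableSpace Ω] {P : Measure Ω}
    (𝒳 : Set (Lp ℝ 1 P)) (ρ : Lp ℝ 1 P → EReal) : Prop :=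
  ∀ X ∈ 𝒳, ∀ Y ∈ 𝒳, Y ≤ X → ρ X ≤ ρ Y

def IsConvexOn {Ω : Type*} [MeasurableSpace Ω] {P : Measure Ω}
    (𝒳 : Set (Lp ℝ 1 P)) (ρ : Lp ℝ 1 P → EReal) : Prop :=
  ∀ X ∈ 𝒳, ∀ Y ∈ 𝒳, ∀ t : ℝ, 0 < t → t < 1 → t • X + (1 - t) • Y ∈ 𝒳 →
    ρ (t • X + (1 - t) • Y) ≤ (t : EReal) * ρ X + ((1 - t : ℝ) : EReal) * ρ Y

def IsQuasiconvexOn {Ω : Type*} [MeasurableSpace Ω] {P : Measure Ω}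
    (𝒳 : Set (Lp ℝ 1 P)) (ρ : Lp ℝ 1 P → EReal) : Prop :=
  ∀ X ∈ 𝒳, ∀ Y ∈ 𝒳, ∀ t : ℝ, 0 < t → t < 1 → t • X + (1 - t) • Y ∈ 𝒳 →
    ρ (t • X + (1 - t) • Y) ≤ max (ρ X) (ρ Y)

/-- Cash-additivity: `ρ (X + s) = ρ X - s` for constants `s`. -/
def IsCashAdditiveOn {Ω : Type*} [MeasurableSpace Ω] {P : Measure Ω} [IsFiniteMeasure P]
    (𝒳 : Set (Lp ℝ 1 P)) (ρ : Lp ℝ 1 P → EReal) : Prop :=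
  ∀ X ∈ 𝒳, ∀ s : ℝ, X + Lp.const 1 P s ∈ 𝒳 → ρ (X + Lp.const 1 P s) = ρ X - (s : EReal)

/-- Lower semicontinuity on all of `L¹` with respect to a topology `τ`: sublevel sets are
`τ`-closed. -/
def IsLSC {Ω : Type*} [MeasurableSpace Ω] {P : Measure Ω}
    (τ : TopologicalSpace (Lp ℝ 1 P)) (ρ : Lp ℝ 1 P → EReal) : Prop :=
  ∀ c : ℝ, IsClosed[τ] {X : Lp ℝ 1 P | ρ X ≤ (c : EReal)}

/-- `ρ̄ (X) = sup_π ρ (𝔼[X | π])`, the supremum over all finite partitions. -/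
def extension {Ω : Type*} [MeasurableSpace Ω] {P : Measure Ω}
    (ρ : Lp ℝ 1 P → EReal) : Lp ℝ 1 P → EReal :=
  fun X => ⨆ π : Partition P, ρ (condE π X)

end DilatationMonotone

end

/-! Every `condE π X` is simple, so it lies in `𝒳`. A dilatation monotone extension of `ρ` therefore
dominates the supremum of the values `ρ (condE π X)`. Conversely, `X` is a norm limit of such
conditional expectations (`exists_condE_near`) and weakly closed sets are norm closed, so a weakly
lower semicontinuous extension cannot exceed that supremum. This gives uniqueness.

Agreement on `𝒳` uses the same approximation together with the Fatou property, which requires a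
common bound in the ideal generated by `𝒳`. Discretising `X` alone gives no such bound, because the
average over a tail `{|X| ≥ N}` may be far larger than `|X|` there. The tail is therefore merged
with a set on which `X` is bounded and whose probability equals the integral of `|X|` over the tail.
The average over the union is then bounded by a constant that does not depend on the accuracy, and
`|X| + K` is a common bound.

For lower semicontinuity, `X ↦ ρ (condE π X)` factors through the finitely many averages of `X` over
the members of `π`. On that finite-dimensional space convergent sequences are dominated by
constants, so the Fatou property is ordinary lower semicontinuity, and a supremum of lower
semicontinuous functionals is again one.

Law-invariance holds because a norm closed set stable under conditional expectations contains, with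
`X`, every `Y` of the same law (`mem_of_identDistrib`). A single averaging over two sets of equal
measure moves their values only halfway towards each other. Countercurrent exchange improves a
proportion `h` to `h + h * (1 - h) ^ 2`, whose only fixed point in `[1/2, 1]` is `1`; by closedness
the values can be swapped completely. Swaps turn a simple function into any other of the same law,
and discretisation through the common law covers the general case. -/

namespace DilatationMonotone

/-! ### Conditional expectations on finite partitions -/

section Partition

variable {Ω : Type*} [MeasurableSpace Ω] {P : Measure Ω}

/-- The sets that do not separate points of a member form a `σ`-algebra containing the partition.
Hence `π.sigma`-measurable functions are constant on members. -/
theorem Partition.mem_iff_mem_of_measurableSet (π : Partition P) {s : Set Ω}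
    (hs : MeasurableSet[π.sigma] s) {A : Set Ω} (hA : A ∈ π.parts) {x y : Ω} (hx : x ∈ A)
    (hy : y ∈ A) : x ∈ s ↔ y ∈ s := by
  induction s, hs using MeasurableSpace.generateFrom_induction with
  | hC t ht _ =>
    by_cases h : t = A
    · subst h; simp [hx, hy]
    · have hd : Disjoint t A := π.pairwiseDisjoint ht hA h
      exact ⟨fun hxt => (Set.disjoint_left.1 hd hxt hx).elim,
        fun hyt => (Set.disjoint_left.1 hd hyt hy).elim⟩
  | empty => simp
  | compl t _ ih => simp [ih]
  | iUnion g _ ih => simp only [Set.mem_iUnion]; exact exists_congr ih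

theorem Partition.exists_mem (π : Partition P) (ω : Ω) : ∃ A ∈ π.parts, ω ∈ A := by
  have h : ω ∈ ⋃₀ (π.parts : Set (Set Ω)) := π.sUnion_eq ▸ Set.mem_univ ω
  simpa using h

theorem condE_ae_eq (π : Partition P) (X : Lp ℝ 1 P) :
    condE π X =ᵐ[P] P[(X : Ω → ℝ) | π.sigma] :=
  Integrable.coeFn_toL1 _

theorem condE_add (π : Partition P) (X Y : Lp ℝ 1 P) :
    condE π (X + Y) = condE π X + condE π Y := by
  refine Lp.ext ?_
  filter_upwards [condE_ae_eq π (X + Y), condE_ae_eq π X, condE_ae_eq π Y,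
    Lp.coeFn_add (condE π X) (condE π Y),
    condExp_congr_ae (m := π.sigma) (Lp.coeFn_add X Y),
    condExp_add (L1.integrable_coeFn X) (L1.integrable_coeFn Y) π.sigma]
    with ω h1 h2 h3 h4 h5 h6
  rw [h1, h5, h6, h4, Pi.add_apply, Pi.add_apply, h2, h3]

theorem condE_smul (π : Partition P) (c : ℝ) (X : Lp ℝ 1 P) :
    condE π (c • X) = c • condE π X := by
  refine Lp.ext ?_
  filter_upwards [condE_ae_eq π (c • X), condE_ae_eq π X, Lp.coeFn_smul c (condE π X),
    condExp_congr_ae (m := π.sigma) (Lp.coeFn_smul c X),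
    condExp_smul (μ := P) c (X : Ω → ℝ) π.sigma] with ω h1 h2 h4 h5 h6
  rw [h1, h5, h6, h4, Pi.smul_apply, Pi.smul_apply, h2]

theorem condE_mono (π : Partition P) {X Y : Lp ℝ 1 P} (h : X ≤ Y) :
    condE π X ≤ condE π Y := by
  rw [← Lp.coeFn_le] at h ⊢
  filter_upwards [condE_ae_eq π X, condE_ae_eq π Y,
    condExp_mono (m := π.sigma) (L1.integrable_coeFn X) (L1.integrable_coeFn Y) h]
    with ω h1 h2 h3
  rwa [h1, h2]

theorem norm_condE_le (π : Partition P) (X : Lp ℝ 1 P) : ‖condE π X‖ ≤ ‖X‖ := by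
  rw [Lp.norm_def, Lp.norm_def]
  refine ENNReal.toReal_mono (Lp.eLpNorm_ne_top X) ?_
  rw [eLpNorm_congr_ae (condE_ae_eq π X)]
  exact eLpNorm_condExp_le_eLpNorm _ le_rfl

theorem condE_sub (π : Partition P) (X Y : Lp ℝ 1 P) :
    condE π (X - Y) = condE π X - condE π Y := by
  rw [eq_sub_iff_add_eq, ← condE_add, sub_add_cancel]

/-- If `Z` is `π`-measurable, then `𝔼[X | π]` approximates `X` at least half as well as `Z`. -/
theorem norm_condE_sub_le (π : Partition P) (X : Lp ℝ 1 P) {Z : Lp ℝ 1 P}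
    (hZ : condE π Z = Z) : ‖condE π X - X‖ ≤ 2 * ‖X - Z‖ := by
  have h : condE π X - X = condE π (X - Z) - (X - Z) := by rw [condE_sub, hZ]; abel
  rw [h]
  linarith [norm_sub_le (condE π (X - Z)) (X - Z), norm_condE_le π (X - Z)]

theorem measure_null_fibers {β : Type*} (g : SimpleFunc Ω β) :
    P (g ⁻¹' {b | P (g ⁻¹' {b}) = 0}) = 0 := by
  classical
  have : g ⁻¹' {b | P (g ⁻¹' {b}) = 0} ⊆
      ⋃ b ∈ g.range.filter (fun b => P (g ⁻¹' {b}) = 0), g ⁻¹' {b} := by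
    intro ω hω
    simp only [Set.mem_iUnion]
    exact ⟨g ω, Finset.mem_filter.2 ⟨g.mem_range_self ω, hω⟩, rfl⟩
  refine measure_mono_null this ((measure_biUnion_null_iff (Finset.countable_toSet _)).2 ?_)
  intro b hb
  exact (Finset.mem_filter.1 hb).2

variable [IsProbabilityMeasure P]

theorem Partition.measureReal_pos (π : Partition P) {A : Set Ω} (hA : A ∈ π.parts) :
    0 < P.real A :=
  ENNReal.toReal_pos (π.measure_ne_zero A hA) (measure_ne_top P A)

theorem Partition.condExp_apply (π : Partition P) {f : Ω → ℝ} (hf : Integrable f P)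
    {A : Set Ω} (hA : A ∈ π.parts) {ω : Ω} (hω : ω ∈ A) :
    (P[f | π.sigma]) ω = (∫ x in A, f x ∂P) / P.real A := by
  have hm : Measurable[π.sigma] (P[f | π.sigma]) := stronglyMeasurable_condExp.measurable
  have hc : ∀ x ∈ A, (P[f | π.sigma]) x = (P[f | π.sigma]) ω := fun x hx =>
    (π.mem_iff_mem_of_measurableSet (hm (measurableSet_singleton _)) hA hω hx).1 rfl
  have hA' : MeasurableSet[π.sigma] A := MeasurableSpace.measurableSet_generateFrom hA
  rw [← setIntegral_condExp π.sigma_le hf hA',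
    setIntegral_congr_fun (π.measurableSet A hA) hc, setIntegral_const, smul_eq_mul,
    mul_div_cancel_left₀ _ (π.measureReal_pos hA).ne']

theorem condE_const (π : Partition P) (s : ℝ) :
    condE π (Lp.const 1 P s) = Lp.const 1 P s := by
  refine Lp.ext ?_
  filter_upwards [condE_ae_eq π (Lp.const 1 P s),
    condExp_congr_ae (m := π.sigma) (Lp.coeFn_const (p := 1) (μ := P) s),
    Lp.coeFn_const (p := 1) (μ := P) s] with ω h1 h2 h3
  rw [h1, h2, h3]
  exact congrFun (condExp_const π.sigma_le s) ω

/-- The average of `f` over the fibres of `g`. -/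
noncomputable def fiberAverage {β : Type*} (P : Measure Ω) (g : SimpleFunc Ω β) (f : Ω → ℝ)
    (ω : Ω) : ℝ :=
  (∫ x in g ⁻¹' {g ω}, f x ∂P) / P.real (g ⁻¹' {g ω})

theorem fiberAverage_ae_eq {β : Type*} (g : SimpleFunc Ω β) {f h : Ω → ℝ}
    (hfh : ∀ ω, ∫ x in g ⁻¹' {g ω}, f x ∂P = h ω * P.real (g ⁻¹' {g ω})) :
    fiberAverage P g f =ᵐ[P] h := by
  filter_upwards [measure_eq_zero_iff_ae_notMem.1 (measure_null_fibers (P := P) g)] with ω hω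
  have : P.real (g ⁻¹' {g ω}) ≠ 0 := ENNReal.toReal_ne_zero.2 ⟨hω, measure_ne_top P _⟩
  rw [fiberAverage, hfh, mul_div_cancel_right₀ _ this]

/-- Up to a null set, the fibres of a simple function form a partition. -/
theorem exists_partition_fiber {β : Type*} (g : SimpleFunc Ω β) :
    ∃ π : Partition P, ∀ X : Lp ℝ 1 P, condE π X =ᵐ[P] fiberAverage P g X := by
  classical
  set N : Set Ω := g ⁻¹' {b | P (g ⁻¹' {b}) = 0} with hN
  have hNm : MeasurableSet N := g.measurableSet_preimage _
  have hN0 : P N = 0 := measure_null_fibers g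
  obtain ⟨ω₀, hω₀⟩ : ∃ ω₀, ω₀ ∉ N := by
    by_contra! h
    have : N = Set.univ := Set.eq_univ_of_forall h
    simp [this] at hN0
  -- Members of a partition must have positive measure, so the null fibres are absorbed into the
  -- non-null fibre through `ω₀`.
  set g' : SimpleFunc Ω β := SimpleFunc.piecewise N hNm (SimpleFunc.const Ω (g ω₀)) g with hg'
  have hg'_eq : ∀ ω, ω ∉ N → g' ω = g ω := fun ω h => by simp [hg', h]
  have hg'_range : ∀ ω, ∃ ω' ∉ N, g' ω = g ω' := by
    intro ω
    by_cases h : ω ∈ N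
    · exact ⟨ω₀, hω₀, by simp [hg', h]⟩
    · exact ⟨ω, h, hg'_eq ω h⟩
  have hfib : ∀ b, (g' ⁻¹' {b} : Set Ω) =ᵐ[P] (g ⁻¹' {b} : Set Ω) := by
    intro b
    have : ∀ᵐ ω ∂P, ω ∉ N := measure_eq_zero_iff_ae_notMem.1 hN0
    filter_upwards [this] with ω hω
    change (g' ω = b) = (g ω = b)
    rw [hg'_eq ω hω]
  let π : Partition P :=
    { parts := g'.range.image fun b => g' ⁻¹' {b}
      measurableSet := by
        intro A hA
        obtain ⟨b, -, rfl⟩ := Finset.mem_image.1 hA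
        exact g'.measurableSet_preimage _
      measure_ne_zero := by
        intro A hA
        obtain ⟨b, hb, rfl⟩ := Finset.mem_image.1 hA
        obtain ⟨ω, rfl⟩ := SimpleFunc.mem_range.1 hb
        obtain ⟨ω', hω', h⟩ := hg'_range ω
        rw [measure_congr (hfib _), h]
        exact hω'
      pairwiseDisjoint := by
        intro A hA B hB hAB
        obtain ⟨b, -, rfl⟩ := Finset.mem_image.1 (Finset.mem_coe.1 hA)
        obtain ⟨c, -, rfl⟩ := Finset.mem_image.1 (Finset.mem_coe.1 hB)
        refine Set.disjoint_left.2 fun ω h1 h2 => hAB ?_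
        have h1 : g' ω = b := h1
        have h2 : g' ω = c := h2
        rw [← h1, ← h2]
      sUnion_eq := by
        refine Set.eq_univ_of_forall fun ω => ?_
        exact ⟨g' ⁻¹' {g' ω}, Finset.mem_coe.2
          (Finset.mem_image_of_mem _ (g'.mem_range_self ω)), rfl⟩ }
  refine ⟨π, fun X => ?_⟩
  have : ∀ᵐ ω ∂P, ω ∉ N := measure_eq_zero_iff_ae_notMem.1 hN0
  filter_upwards [this, condE_ae_eq π X] with ω hω h
  have hmem : g' ⁻¹' {g' ω} ∈ π.parts := Finset.mem_image_of_mem _ (g'.mem_range_self ω)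
  rw [h, π.condExp_apply (L1.integrable_coeFn X) hmem rfl, fiberAverage,
    setIntegral_congr_set (hfib _), measureReal_congr (hfib _), hg'_eq ω hω]

end Partition

/-! ### Intermediate values of a nonatomic measure -/

section Nonatomic

variable {Ω : Type*} [MeasurableSpace Ω] {P : Measure Ω} [IsProbabilityMeasure P]

/-- Of a proper piece and its complement in the set, one has at most half the measure, so repeated
splitting halves it each time. -/
theorem Nonatomic.exists_subset_measureReal_le (hP : Nonatomic P) {A : Set Ω}
    (hA : MeasurableSet A) (hA0 : 0 < P.real A) (n : ℕ) :
    ∃ B ⊆ A, MeasurableSet B ∧ 0 < P.real B ∧ P.real B ≤ P.real A / 2 ^ n := by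
  induction n with
  | zero => exact ⟨A, subset_rfl, hA, hA0, by simp⟩
  | succ n ih =>
    obtain ⟨B, hBA, hB, hB0, hBn⟩ := ih
    obtain ⟨D, hDB, hD, hD0, hDlt⟩ := hP B hB (ENNReal.toReal_pos_iff.1 hB0).1
    have hD0' : 0 < P.real D := ENNReal.toReal_pos hD0.ne' (measure_ne_top P D)
    have hDlt' : P.real D < P.real B :=
      ENNReal.toReal_strict_mono (measure_ne_top P B) hDlt
    have hdiff : P.real (B \ D) = P.real B - P.real D := measureReal_sdiff hDB hD
    have hpow : P.real A / 2 ^ (n + 1) = P.real A / 2 ^ n / 2 := by rw [pow_succ]; ring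
    rcases le_total (P.real D) (P.real B / 2) with h | h
    · exact ⟨D, hDB.trans hBA, hD, hD0', by rw [hpow]; linarith⟩
    · exact ⟨B \ D, Set.sdiff_subset.trans hBA, hB.diff hD, by rw [hdiff]; linarith,
        by rw [hdiff, hpow]; linarith⟩

/-- **Sierpiński's theorem**: a nonatomic measure takes all intermediate values. -/
theorem Nonatomic.exists_subset_measureReal_eq (hP : Nonatomic P) {A : Set Ω}
    (hA : MeasurableSet A) {c : ℝ} (hc0 : 0 ≤ c) (hcA : c ≤ P.real A) :
    ∃ B ⊆ A, MeasurableSet B ∧ P.real B = c := by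
  let T := {B : Set Ω // B ⊆ A ∧ MeasurableSet B ∧ P.real B ≤ c}
  -- Greedy choice: an admissible enlargement of `B` that gains at least half of the largest
  -- possible gain.
  have hstep : ∀ B : T, ∃ B' : T, B.1 ⊆ B'.1 ∧ ∀ D : T, B.1 ⊆ D.1 →
      P.real D.1 - P.real B.1 ≤ 2 * (P.real B'.1 - P.real B.1) := by
    intro B
    set S : Set ℝ := {r | ∃ D : T, B.1 ⊆ D.1 ∧ r = P.real D.1} with hS
    have hbdd : BddAbove S := ⟨c, by rintro _ ⟨D, -, rfl⟩; exact D.2.2.2⟩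
    have hBS : P.real B.1 ∈ S := ⟨B, subset_rfl, rfl⟩
    have hle : P.real B.1 ≤ sSup S := le_csSup hbdd hBS
    rcases hle.eq_or_lt with h | h
    · refine ⟨B, subset_rfl, fun D hD => ?_⟩
      have : P.real D.1 ≤ sSup S := le_csSup hbdd ⟨D, hD, rfl⟩
      linarith
    · obtain ⟨_, ⟨B', hB', rfl⟩, hlt⟩ :=
        exists_lt_of_lt_csSup ⟨_, hBS⟩ (show (sSup S + P.real B.1) / 2 < sSup S by linarith)
      refine ⟨B', hB', fun D hD => ?_⟩
      have : P.real D.1 ≤ sSup S := le_csSup hbdd ⟨D, hD, rfl⟩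
      linarith
  choose next hnext_sub hnext using hstep
  let B : ℕ → T := fun n => next^[n] ⟨∅, Set.empty_subset A, MeasurableSet.empty, by simpa⟩
  have hBsucc : ∀ n, B (n + 1) = next (B n) := fun n => Function.iterate_succ_apply' _ _ _
  have hmono : Monotone fun n => (B n).1 := monotone_nat_of_le_succ fun n => by
    rw [hBsucc]; exact hnext_sub _
  set U : Set Ω := ⋃ n, (B n).1 with hU
  have hUA : U ⊆ A := Set.iUnion_subset fun n => (B n).2.1
  have hUm : MeasurableSet U := MeasurableSet.iUnion fun n => (B n).2.2.1
  have hlim : Tendsto (fun n => P.real (B n).1) atTop (𝓝 (P.real U)) :=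
    (ENNReal.tendsto_toReal (measure_ne_top P U)).comp (tendsto_measure_iUnion_atTop hmono)
  have hUc : P.real U ≤ c := le_of_tendsto' hlim fun n => (B n).2.2.2
  refine ⟨U, hUA, hUm, hUc.antisymm ?_⟩
  by_contra! hlt
  have hdiff : P.real (A \ U) = P.real A - P.real U := measureReal_sdiff hUA hUm
  obtain ⟨n, hn⟩ := exists_pow_lt_of_lt_one (show 0 < (c - P.real U) / P.real (A \ U) from
    div_pos (by linarith) (by linarith)) (show (1 / 2 : ℝ) < 1 by norm_num)
  obtain ⟨E, hEA, hE, hE0, hEn⟩ :=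
    hP.exists_subset_measureReal_le (hA.diff hUm) (by linarith) n
  have hEc : P.real E ≤ c - P.real U := by
    refine hEn.trans ?_
    rw [lt_div_iff₀ (by linarith), one_div, inv_pow] at hn
    rw [div_eq_inv_mul]
    exact hn.le
  -- `E` could have been added at every stage, so each greedy gain is at least `P.real E / 2`; but
  -- the gains tend to `0`.
  have hEB : ∀ n, P.real E ≤ 2 * (P.real (B (n + 1)).1 - P.real (B n).1) := by
    intro n
    have hsub : (B n).1 ⊆ U := Set.subset_iUnion (fun n => (B n).1) n
    have hun : P.real ((B n).1 ∪ E) = P.real (B n).1 + P.real E :=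
      measureReal_union (Set.disjoint_left.2 fun ω h1 h2 => (hEA h2).2 (hsub h1)) hE
    have := hnext (B n) ⟨(B n).1 ∪ E, Set.union_subset (B n).2.1 (hEA.trans Set.sdiff_subset),
      (B n).2.2.1.union hE, by
        rw [hun]; linarith [measureReal_mono (μ := P) hsub]⟩ Set.subset_union_left
    rw [hBsucc]
    simp only [hun] at this
    linarith
  have h0 : Tendsto (fun n => 2 * (P.real (B (n + 1)).1 - P.real (B n).1)) atTop (𝓝 0) := by
    simpa using ((hlim.comp (tendsto_add_atTop_nat 1)).sub hlim).const_mul 2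
  linarith [ge_of_tendsto' h0 hEB]

end Nonatomic

/-! ### Exchange of values between sets of equal measure -/

section Simple

variable {Ω : Type*} [MeasurableSpace Ω]

/-- The class of a simple function in `L¹`. -/
noncomputable def simpleL1 (P : Measure Ω) [IsFiniteMeasure P] (f : SimpleFunc Ω ℝ) :
    Lp ℝ 1 P :=
  f.integrable_of_isFiniteMeasure.toL1 f

variable {P : Measure Ω} [IsProbabilityMeasure P]

theorem coeFn_simpleL1 (f : SimpleFunc Ω ℝ) : simpleL1 P f =ᵐ[P] f :=
  Integrable.coeFn_toL1 _

theorem simpleL1_congr {f g : SimpleFunc Ω ℝ} (h : f =ᵐ[P] g) :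
    simpleL1 P f = simpleL1 P g :=
  Lp.ext ((coeFn_simpleL1 f).trans (h.trans (coeFn_simpleL1 g).symm))

theorem simpleL1_mem_simpleRV (f : SimpleFunc Ω ℝ) : simpleL1 P f ∈ simpleRV P :=
  ⟨f, rfl⟩

theorem norm_le_of_ae_le {X : Lp ℝ 1 P} {c : ℝ} (hc : 0 ≤ c) (h : ∀ᵐ ω ∂P, |X ω| ≤ c) :
    ‖X‖ ≤ c := by
  simpa [measureUnivNNReal] using Lp.norm_le_of_ae_bound (p := 1) (f := X) hc h

theorem norm_simpleL1_sub_le {f g : SimpleFunc Ω ℝ} {c : ℝ} (hc : 0 ≤ c)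
    (h : ∀ ω, |f ω - g ω| ≤ c) : ‖simpleL1 P f - simpleL1 P g‖ ≤ c := by
  refine norm_le_of_ae_le hc ?_
  filter_upwards [coeFn_simpleL1 (P := P) f, coeFn_simpleL1 (P := P) g,
    Lp.coeFn_sub (simpleL1 P f) (simpleL1 P g)] with ω h1 h2 h3
  rw [h3, Pi.sub_apply, h1, h2]
  exact h ω

theorem condE_simpleL1_eq {β : Type*} {g : SimpleFunc Ω β} {π : Partition P}
    (hπ : ∀ X : Lp ℝ 1 P, condE π X =ᵐ[P] fiberAverage P g X) {f f' : SimpleFunc Ω ℝ}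
    (h : ∀ ω, ∫ x in g ⁻¹' {g ω}, f x ∂P = f' ω * P.real (g ⁻¹' {g ω})) :
    condE π (simpleL1 P f) = simpleL1 P f' := by
  refine Lp.ext ?_
  refine (hπ _).trans (((fiberAverage_ae_eq g fun ω => ?_)).trans (coeFn_simpleL1 f').symm)
  rw [← h ω]
  exact integral_congr_ae (ae_restrict_of_ae (coeFn_simpleL1 f))

/-- The set `C` is stable under the operation that, on disjoint sets `A` and `B` of equal measure
on which a simple function has values `a` and `b`, lets these values move towards each other by
the proportion `h` of their distance. -/
def IsStableUnderTransfer (C : Set (Lp ℝ 1 P)) (h : ℝ) : Prop :=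
  ∀ (f f' : SimpleFunc Ω ℝ) (A B : Set Ω) (a b : ℝ), MeasurableSet A → MeasurableSet B →
    Disjoint A B → P.real A = P.real B → (∀ ω ∈ A, f ω = a) → (∀ ω ∈ B, f ω = b) →
    (∀ ω ∈ A, f' ω = a + h * (b - a)) → (∀ ω ∈ B, f' ω = b + h * (a - b)) →
    (∀ ω, ω ∉ A → ω ∉ B → f' ω = f ω) → simpleL1 P f ∈ C → simpleL1 P f' ∈ C

variable {C : Set (Lp ℝ 1 P)}

theorem isStableUnderTransfer_half (hC : ∀ X ∈ C, ∀ π : Partition P, condE π X ∈ C) :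
    IsStableUnderTransfer C (1 / 2) := by
  intro f f' A B a b hA hB hAB hPAB hfA hfB hfA' hfB' hf' hfC
  -- The label `none` merges `A` and `B` into one fibre and keeps it apart from other points where
  -- `f` happens to take the value `a` or `b`.
  let g : SimpleFunc Ω (Option ℝ) :=
    SimpleFunc.piecewise (A ∪ B) (hA.union hB) (SimpleFunc.const Ω none) (f.map some)
  have hg1 : ∀ ω ∈ A ∪ B, g ω = none := fun ω h => if_pos h
  have hg2 : ∀ ω ∉ A ∪ B, g ω = some (f ω) := fun ω h => if_neg h
  obtain ⟨π, hπ⟩ := exists_partition_fiber (P := P) g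
  suffices condE π (simpleL1 P f) = simpleL1 P f' from this ▸ hC _ hfC π
  refine condE_simpleL1_eq hπ ?_
  intro ω
  by_cases h : ω ∈ A ∪ B
  · have hfib : g ⁻¹' {g ω} = A ∪ B := by
      ext x
      rw [hg1 ω h]
      by_cases hx : x ∈ A ∪ B
      · simpa [hx] using hg1 x hx
      · simp [hx, hg2 x hx]
    have hval : f' ω = (a + b) / 2 := by
      rcases h with h | h
      · rw [hfA' ω h]; ring
      · rw [hfB' ω h]; ring
    rw [hfib, setIntegral_union hAB hB f.integrable_of_isFiniteMeasure.integrableOn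
      f.integrable_of_isFiniteMeasure.integrableOn, setIntegral_congr_fun hA hfA,
      setIntegral_congr_fun hB hfB, setIntegral_const, setIntegral_const,
      measureReal_union hAB hB, hval, hPAB]
    simp only [smul_eq_mul]
    ring
  · have hfib : ∀ x ∈ g ⁻¹' {g ω}, f x = f ω := by
      intro x hx
      have hx : g x = g ω := hx
      rw [hg2 ω h] at hx
      by_cases hx' : x ∈ A ∪ B
      · rw [hg1 x hx'] at hx; cases hx
      · rw [hg2 x hx'] at hx; exact Option.some.inj hx
    rw [setIntegral_congr_fun (g.measurableSet_preimage _) hfib, setIntegral_const,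
      hf' ω (fun h' => h (Or.inl h')) (fun h' => h (Or.inr h')), smul_eq_mul, mul_comm]

/-- Countercurrent exchange: halving both sets and letting each half of `A` exchange with each
half of `B` transfers more than a single exchange does. -/
theorem IsStableUnderTransfer.countercurrent (hP : Nonatomic P) {h : ℝ}
    (hh : IsStableUnderTransfer C h) (h2 : IsStableUnderTransfer C (1 / 2)) :
    IsStableUnderTransfer C (h + h * (1 - h) ^ 2) := by
  intro f f' A B a b hA hB hAB hPAB hfA hfB hfA' hfB' hf' hfC
  obtain ⟨A₁, hA₁A, hA₁, hPA₁⟩ := hP.exists_subset_measureReal_eq hA (c := P.real A / 2)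
    (by positivity) (by linarith [measureReal_nonneg (μ := P) (s := A)])
  obtain ⟨B₁, hB₁B, hB₁, hPB₁⟩ := hP.exists_subset_measureReal_eq hB (c := P.real B / 2)
    (by positivity) (by linarith [measureReal_nonneg (μ := P) (s := B)])
  set A₂ := A \ A₁ with hA₂def
  set B₂ := B \ B₁ with hB₂def
  have hA₂ : MeasurableSet A₂ := hA.diff hA₁
  have hB₂ : MeasurableSet B₂ := hB.diff hB₁
  have hPA₂ : P.real A₂ = P.real A / 2 := by rw [measureReal_sdiff hA₁A hA₁, hPA₁]; ring
  have hPB₂ : P.real B₂ = P.real B / 2 := by rw [measureReal_sdiff hB₁B hB₁, hPB₁]; ring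
  have hA₂A : A₂ ⊆ A := Set.sdiff_subset
  have hB₂B : B₂ ⊆ B := Set.sdiff_subset
  have dAA : Disjoint A₁ A₂ := Set.disjoint_sdiff_right
  have dBB : Disjoint B₁ B₂ := Set.disjoint_sdiff_right
  have d11 : Disjoint A₁ B₁ := hAB.mono hA₁A hB₁B
  have d12 : Disjoint A₁ B₂ := hAB.mono hA₁A hB₂B
  have d21 : Disjoint A₂ B₁ := hAB.mono hA₂A hB₁B
  have d22 : Disjoint A₂ B₂ := hAB.mono hA₂A hB₂B
  -- The values on the four halves `A₁`, `A₂`, `B₁`, `B₂` are the state of the exchange; off them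
  -- `f` is untouched.
  let F : ℝ → ℝ → ℝ → ℝ → SimpleFunc Ω ℝ := fun u v w z =>
    .piecewise A₁ hA₁ (.const Ω u) (.piecewise A₂ hA₂ (.const Ω v)
      (.piecewise B₁ hB₁ (.const Ω w) (.piecewise B₂ hB₂ (.const Ω z) f)))
  have F1 : ∀ u v w z, ∀ ω ∈ A₁, F u v w z ω = u := fun u v w z ω hω => by
    simp [F, hω]
  have F2 : ∀ u v w z, ∀ ω ∈ A₂, F u v w z ω = v := fun u v w z ω hω => by
    simp [F, hω, Set.disjoint_right.1 dAA hω]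
  have F3 : ∀ u v w z, ∀ ω ∈ B₁, F u v w z ω = w := fun u v w z ω hω => by
    simp [F, hω, Set.disjoint_right.1 d11 hω, Set.disjoint_right.1 d21 hω]
  have F4 : ∀ u v w z, ∀ ω ∈ B₂, F u v w z ω = z := fun u v w z ω hω => by
    simp [F, hω, Set.disjoint_right.1 d12 hω, Set.disjoint_right.1 d22 hω,
      Set.disjoint_right.1 dBB hω]
  have F5 : ∀ u v w z, ∀ ω, ω ∉ A₁ → ω ∉ A₂ → ω ∉ B₁ → ω ∉ B₂ → F u v w z ω = f ω :=
    fun u v w z ω h1 h2 h3 h4 => by simp [F, h1, h2, h3, h4]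
  have hcover : ∀ ω, ω ∈ A₁ ∨ ω ∈ A₂ ∨ ω ∈ B₁ ∨ ω ∈ B₂ ∨ (ω ∉ A ∧ ω ∉ B) := by
    intro ω
    by_cases h1 : ω ∈ A₁ <;> by_cases h2 : ω ∈ B₁ <;> by_cases h3 : ω ∈ A <;>
      by_cases h4 : ω ∈ B <;> simp [A₂, B₂, h1, h2, h3, h4]
  have hF : ∀ (u v w z : ℝ) (k : SimpleFunc Ω ℝ), (∀ ω ∈ A₁, k ω = u) → (∀ ω ∈ A₂, k ω = v) →
      (∀ ω ∈ B₁, k ω = w) → (∀ ω ∈ B₂, k ω = z) → (∀ ω, ω ∉ A → ω ∉ B → k ω = f ω) →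
      F u v w z = k := by
    intro u v w z k h1 h2 h3 h4 h5
    ext ω
    rcases hcover ω with h | h | h | h | ⟨hA', hB'⟩
    · rw [h1 ω h, F1 _ _ _ _ ω h]
    · rw [h2 ω h, F2 _ _ _ _ ω h]
    · rw [h3 ω h, F3 _ _ _ _ ω h]
    · rw [h4 ω h, F4 _ _ _ _ ω h]
    · rw [h5 ω hA' hB', F5 _ _ _ _ ω (fun h => hA' (hA₁A h)) (fun h => hA' (hA₂A h))
        (fun h => hB' (hB₁B h)) (fun h => hB' (hB₂B h))]
  have hoff : ∀ u v w z u' v' w' z', ∀ ω, (ω ∈ A₁ → u = u') → (ω ∈ A₂ → v = v') →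
      (ω ∈ B₁ → w = w') → (ω ∈ B₂ → z = z') → F u v w z ω = F u' v' w' z' ω := by
    intro u v w z u' v' w' z' ω h1 h2 h3 h4
    rcases hcover ω with h | h | h | h | ⟨hA', hB'⟩
    · rw [F1 _ _ _ _ ω h, F1 _ _ _ _ ω h, h1 h]
    · rw [F2 _ _ _ _ ω h, F2 _ _ _ _ ω h, h2 h]
    · rw [F3 _ _ _ _ ω h, F3 _ _ _ _ ω h, h3 h]
    · rw [F4 _ _ _ _ ω h, F4 _ _ _ _ ω h, h4 h]
    · have h1 := fun h => hA' (hA₁A (a := ω) h)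
      have h2 := fun h => hA' (hA₂A (a := ω) h)
      have h3 := fun h => hB' (hB₁B (a := ω) h)
      have h4 := fun h => hB' (hB₂B (a := ω) h)
      rw [F5 _ _ _ _ ω h1 h2 h3 h4, F5 _ _ _ _ ω h1 h2 h3 h4]
  have s11 : ∀ u v w z, simpleL1 P (F u v w z) ∈ C →
      simpleL1 P (F (u + h * (w - u)) v (w + h * (u - w)) z) ∈ C := fun u v w z =>
    hh _ _ A₁ B₁ u w hA₁ hB₁ d11 (by rw [hPA₁, hPB₁, hPAB]) (F1 _ _ _ _) (F3 _ _ _ _)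
      (F1 _ _ _ _) (F3 _ _ _ _)
      fun ω n1 n2 => hoff _ _ _ _ _ _ _ _ ω (fun h => (n1 h).elim) (fun _ => rfl)
        (fun h => (n2 h).elim) (fun _ => rfl)
  have s12 : ∀ u v w z, simpleL1 P (F u v w z) ∈ C →
      simpleL1 P (F (u + h * (z - u)) v w (z + h * (u - z))) ∈ C := fun u v w z =>
    hh _ _ A₁ B₂ u z hA₁ hB₂ d12 (by rw [hPA₁, hPB₂, hPAB]) (F1 _ _ _ _) (F4 _ _ _ _)
      (F1 _ _ _ _) (F4 _ _ _ _)
      fun ω n1 n2 => hoff _ _ _ _ _ _ _ _ ω (fun h => (n1 h).elim) (fun _ => rfl)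
        (fun _ => rfl) (fun h => (n2 h).elim)
  have s21 : ∀ u v w z, simpleL1 P (F u v w z) ∈ C →
      simpleL1 P (F u (v + h * (w - v)) (w + h * (v - w)) z) ∈ C := fun u v w z =>
    hh _ _ A₂ B₁ v w hA₂ hB₁ d21 (by rw [hPA₂, hPB₁, hPAB]) (F2 _ _ _ _) (F3 _ _ _ _)
      (F2 _ _ _ _) (F3 _ _ _ _)
      fun ω n1 n2 => hoff _ _ _ _ _ _ _ _ ω (fun _ => rfl) (fun h => (n1 h).elim)
        (fun h => (n2 h).elim) (fun _ => rfl)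
  have s22 : ∀ u v w z, simpleL1 P (F u v w z) ∈ C →
      simpleL1 P (F u (v + h * (z - v)) w (z + h * (v - z))) ∈ C := fun u v w z =>
    hh _ _ A₂ B₂ v z hA₂ hB₂ d22 (by rw [hPA₂, hPB₂, hPAB]) (F2 _ _ _ _) (F4 _ _ _ _)
      (F2 _ _ _ _) (F4 _ _ _ _)
      fun ω n1 n2 => hoff _ _ _ _ _ _ _ _ ω (fun _ => rfl) (fun h => (n1 h).elim)
        (fun _ => rfl) (fun h => (n2 h).elim)
  have sA : ∀ u v w z, simpleL1 P (F u v w z) ∈ C →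
      simpleL1 P (F (u + 1 / 2 * (v - u)) (v + 1 / 2 * (u - v)) w z) ∈ C := fun u v w z =>
    h2 _ _ A₁ A₂ u v hA₁ hA₂ dAA (by rw [hPA₁, hPA₂]) (F1 _ _ _ _) (F2 _ _ _ _)
      (F1 _ _ _ _) (F2 _ _ _ _)
      fun ω n1 n2 => hoff _ _ _ _ _ _ _ _ ω (fun h => (n1 h).elim) (fun h => (n2 h).elim)
        (fun _ => rfl) (fun _ => rfl)
  have sB : ∀ u v w z, simpleL1 P (F u v w z) ∈ C →
      simpleL1 P (F u v (w + 1 / 2 * (z - w)) (z + 1 / 2 * (w - z))) ∈ C := fun u v w z =>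
    h2 _ _ B₁ B₂ w z hB₁ hB₂ dBB (by rw [hPB₁, hPB₂]) (F3 _ _ _ _) (F4 _ _ _ _)
      (F3 _ _ _ _) (F4 _ _ _ _)
      fun ω n1 n2 => hoff _ _ _ _ _ _ _ _ ω (fun _ => rfl) (fun _ => rfl)
        (fun h => (n1 h).elim) (fun h => (n2 h).elim)
  have hstart : simpleL1 P (F a a b b) ∈ C := by
    rwa [hF a a b b f (fun ω hω => hfA ω (hA₁A hω)) (fun ω hω => hfA ω (hA₂A hω))
      (fun ω hω => hfB ω (hB₁B hω)) (fun ω hω => hfB ω (hB₂B hω)) (fun _ _ _ => rfl)]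
  -- `A₁` meets `B₁` and `B₂`, then `A₂` meets both, and finally `A` and `B` are levelled. For `a =
  -- 0` and `b = 1` the halves of `A` reach `2h - h²` and `2h - 3h² + 2h³`, with mean `h + h(1 -
  -- h)²`.
  have hend := sB _ _ _ _ (sA _ _ _ _ (s22 _ _ _ _ (s21 _ _ _ _ (s12 _ _ _ _
    (s11 _ _ _ _ hstart)))))
  rw [hF _ _ _ _ f' (fun ω hω => (hfA' ω (hA₁A hω)).trans (by ring))
    (fun ω hω => (hfA' ω (hA₂A hω)).trans (by ring))
    (fun ω hω => (hfB' ω (hB₁B hω)).trans (by ring))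
    (fun ω hω => (hfB' ω (hB₂B hω)).trans (by ring)) hf'] at hend
  exact hend

/-- For fixed `f`, `A` and `B`, the transferred function depends on the proportion continuously in
the uniform norm, hence in `L¹`. -/
theorem isClosed_setOf_isStableUnderTransfer (hCc : IsClosed C) :
    IsClosed {h : ℝ | IsStableUnderTransfer C h} := by
  refine IsSeqClosed.isClosed fun u h hu hlim => ?_
  intro f f' A B a b hA hB hAB hPAB hfA hfB hfA' hfB' hf' hfC
  have hnA : ∀ ω ∈ B, ω ∉ A := fun ω hω => Set.disjoint_right.1 hAB hω
  let F : ℕ → SimpleFunc Ω ℝ := fun n =>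
    .piecewise A hA (.const Ω (a + u n * (b - a))) (.piecewise B hB
      (.const Ω (b + u n * (a - b))) f)
  have F1 : ∀ n, ∀ ω ∈ A, F n ω = a + u n * (b - a) := fun n ω hω => by simp [F, hω]
  have F2 : ∀ n, ∀ ω ∈ B, F n ω = b + u n * (a - b) := fun n ω hω => by
    simp [F, hω, hnA ω hω]
  have F3 : ∀ n, ∀ ω, ω ∉ A → ω ∉ B → F n ω = f ω := fun n ω h1 h2 => by simp [F, h1, h2]
  have hFC : ∀ n, simpleL1 P (F n) ∈ C := fun n =>
    hu n f (F n) A B a b hA hB hAB hPAB hfA hfB (F1 n) (F2 n) (F3 n) hfC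
  have hFlim : Tendsto (fun n => simpleL1 P (F n)) atTop (𝓝 (simpleL1 P f')) := by
    rw [tendsto_iff_norm_sub_tendsto_zero]
    refine squeeze_zero (g := fun n => |u n - h| * |b - a|) (fun n => norm_nonneg _)
      (fun n => norm_simpleL1_sub_le (by positivity) fun ω => ?_) ?_
    · by_cases h1 : ω ∈ A
      · rw [F1 n ω h1, hfA' ω h1, ← abs_mul]
        exact (congrArg abs (by ring)).le
      · by_cases h2 : ω ∈ B
        · rw [F2 n ω h2, hfB' ω h2, ← abs_mul, ← abs_neg]
          exact (congrArg abs (by ring)).le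
        · rw [F3 n ω h1 h2, hf' ω h1 h2, sub_self, abs_zero]
          positivity
    · have := ((hlim.sub_const h).abs).mul_const |b - a|
      simpa using this
  exact hCc.mem_of_tendsto hFlim (Eventually.of_forall hFC)

/-- A closed set that is stable under conditional expectations is stable under swapping the values
on two sets of equal measure. -/
theorem isStableUnderTransfer_one (hP : Nonatomic P) (hCc : IsClosed C)
    (hC : ∀ X ∈ C, ∀ π : Partition P, condE π X ∈ C) : IsStableUnderTransfer C 1 := by
  set H : Set ℝ := {h | IsStableUnderTransfer C h} ∩ Set.Icc (1 / 2) 1 with hH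
  have hhalf := isStableUnderTransfer_half hC
  have hHc : IsClosed H := (isClosed_setOf_isStableUnderTransfer hCc).inter isClosed_Icc
  have hbdd : BddAbove H := ⟨1, fun h hh => hh.2.2⟩
  obtain ⟨hs, hs1, hs2⟩ : sSup H ∈ H :=
    hHc.csSup_mem ⟨1 / 2, hhalf, by norm_num, by norm_num⟩ hbdd
  set s := sSup H
  -- The improved proportion stays at most `1`, so it belongs to `H` and cannot exceed the supremum.
  -- As `s ≥ 1 / 2`, this forces `s = 1`.
  have hnext : s + s * (1 - s) ^ 2 ≤ s := le_csSup hbdd ⟨hs.countercurrent hP hhalf,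
    by nlinarith [mul_nonneg (show 0 ≤ s by linarith) (sq_nonneg (1 - s))],
    by nlinarith [mul_nonneg (show 0 ≤ s by linarith) (show 0 ≤ 1 - s by linarith),
      mul_nonneg (mul_nonneg (show 0 ≤ s by linarith) (show 0 ≤ 1 - s by linarith))
        (show 0 ≤ s by linarith), sq_nonneg (1 - s)]⟩
  have h0 : (1 - s) ^ 2 = 0 := le_antisymm (by nlinarith [sq_nonneg (1 - s)]) (sq_nonneg _)
  have : s = 1 := by linarith [pow_eq_zero_iff (two_ne_zero) |>.1 h0]
  exact this ▸ hs

end Simple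

/-! ### Tails of integrable functions -/

section Auxiliary

variable {Ω : Type*} [MeasurableSpace Ω] {P : Measure Ω}

theorem measurable_coeFn (X : Lp ℝ 1 P) : Measurable (X : Ω → ℝ) :=
  (Lp.stronglyMeasurable X).measurable

theorem exists_setIntegral_tail_lt {f : Ω → ℝ} (hf : Integrable f P) (hfm : Measurable f)
    (M : ℝ) {ε : ℝ} (hε : 0 < ε) :
    ∃ N : ℝ, M ≤ N ∧ ∫ ω in {ω | N ≤ |f ω|}, |f ω| ∂P < ε := by
  have hlim := tendsto_setIntegral_of_antitone (μ := P) (f := fun ω => |f ω|)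
    (s := fun n : ℕ => {ω | (n : ℝ) ≤ |f ω|})
    (fun n => measurableSet_le measurable_const hfm.abs)
    (fun m n hmn ω (hω : (n : ℝ) ≤ |f ω|) => (Nat.cast_le.2 hmn).trans hω)
    ⟨0, hf.abs.integrableOn⟩
  have hemp : ⋂ n : ℕ, {ω | (n : ℝ) ≤ |f ω|} = ∅ := by
    refine Set.eq_empty_of_forall_notMem fun ω hω => ?_
    obtain ⟨n, hn⟩ := exists_nat_gt |f ω|
    exact absurd (Set.mem_iInter.1 hω n) (not_le.2 hn)
  rw [hemp, setIntegral_empty] at hlim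
  obtain ⟨n, hn, hM⟩ := ((hlim.eventually_lt_const hε).and
    (eventually_ge_atTop ⌈M⌉₊)).exists
  exact ⟨n, (Nat.le_ceil M).trans (Nat.cast_le.2 hM), hn⟩

end Auxiliary

/-! ### Law-invariance of closed sets stable under conditioning -/

section Law

variable {Ω : Type*} [MeasurableSpace Ω] {P : Measure Ω} [IsProbabilityMeasure P]
  {C : Set (Lp ℝ 1 P)}

theorem measureReal_split {A B : Set Ω} (hA : MeasurableSet A) (hB : MeasurableSet B)
    (hAB : Disjoint A B) (S : Set Ω) :
    P.real S = P.real (S ∩ A) + P.real (S ∩ B) + P.real ((S \ A) \ B) := by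
  rw [← measureReal_inter_add_sdiff (s := S) hA, ← measureReal_inter_add_sdiff (s := S \ A) hB]
  have : (S \ A) ∩ B = S ∩ B := by
    ext ω
    simp only [Set.mem_inter_iff, Set.mem_sdiff]
    exact ⟨fun h => ⟨h.1.1, h.2⟩, fun h => ⟨⟨h.1, Set.disjoint_right.1 hAB h.2⟩, h.2⟩⟩
  rw [this]
  ring

/-- Swapping the values on two sets of equal measure does not change the distribution. -/
theorem measureReal_preimage_swap {A B : Set Ω} {a b : ℝ} {f f' : SimpleFunc Ω ℝ}
    (hA : MeasurableSet A) (hB : MeasurableSet B) (hAB : Disjoint A B)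
    (hPAB : P.real A = P.real B) (hfA : ∀ ω ∈ A, f ω = a) (hfB : ∀ ω ∈ B, f ω = b)
    (hfA' : ∀ ω ∈ A, f' ω = b) (hfB' : ∀ ω ∈ B, f' ω = a)
    (hf' : ∀ ω, ω ∉ A → ω ∉ B → f' ω = f ω) (v : ℝ) :
    P.real (f' ⁻¹' {v}) = P.real (f ⁻¹' {v}) := by
  have hin : ∀ {k : SimpleFunc Ω ℝ} {D : Set Ω} {d : ℝ}, (∀ ω ∈ D, k ω = d) →
      P.real (k ⁻¹' {v} ∩ D) = if d = v then P.real D else 0 := by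
    intro k D d hk
    split_ifs with h
    · congr 1
      exact Set.inter_eq_right.2 fun ω hω => (hk ω hω).trans h
    · have : k ⁻¹' {v} ∩ D = ∅ :=
        Set.eq_empty_of_forall_notMem fun ω hω => h ((hk ω hω.2).symm.trans hω.1)
      rw [this, measureReal_empty]
  have hoff : (f' ⁻¹' {v} \ A) \ B = (f ⁻¹' {v} \ A) \ B := by
    ext ω
    simp only [Set.mem_sdiff, Set.mem_preimage, Set.mem_singleton_iff]
    constructor
    · rintro ⟨⟨h1, h2⟩, h3⟩; exact ⟨⟨(hf' ω h2 h3).symm.trans h1, h2⟩, h3⟩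
    · rintro ⟨⟨h1, h2⟩, h3⟩; exact ⟨⟨(hf' ω h2 h3).trans h1, h2⟩, h3⟩
  rw [measureReal_split hA hB hAB, measureReal_split hA hB hAB (f ⁻¹' {v}), hin hfA, hin hfB,
    hin hfA', hin hfB', hoff, hPAB]
  ring

/-- By swaps, the set where `f` has the value `x` can be moved to the set where `g` does. -/
theorem exists_simpleFunc_match_value (hP : Nonatomic P) (hswap : IsStableUnderTransfer C 1)
    (g : SimpleFunc Ω ℝ) (x : ℝ) (t : Finset ℝ) :
    ∀ f : SimpleFunc Ω ℝ, simpleL1 P f ∈ C →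
      (∀ v, P.real (f ⁻¹' {v}) = P.real (g ⁻¹' {v})) →
      (∀ᵐ ω ∂P, g ω = x → f ω ≠ x → f ω ∈ t) →
      ∃ f' : SimpleFunc Ω ℝ, simpleL1 P f' ∈ C ∧
        (∀ v, P.real (f' ⁻¹' {v}) = P.real (g ⁻¹' {v})) ∧
        (∀ᵐ ω ∂P, g ω = x → f' ω = x) ∧
        ∀ s : Finset ℝ, (∀ᵐ ω ∂P, f ω ≠ g ω → f ω ∈ s) →
          ∀ᵐ ω ∂P, f' ω ≠ g ω → f' ω ∈ s := by
  induction t using Finset.induction_on with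
  | empty =>
    intro f hfC hlaw hft
    refine ⟨f, hfC, hlaw, ?_, fun s hs => hs⟩
    filter_upwards [hft] with ω hω hgx
    by_contra h
    simpa using hω hgx h
  | insert z t hz ih =>
    intro f hfC hlaw hft
    set B : Set Ω := g ⁻¹' {x} ∩ f ⁻¹' {z} with hBdef
    have hBm : MeasurableSet B := (g.measurableSet_preimage _).inter (f.measurableSet_preimage _)
    have hskip : (∀ᵐ ω ∂P, g ω = x → f ω ≠ x → f ω ≠ z) →
        ∀ᵐ ω ∂P, g ω = x → f ω ≠ x → f ω ∈ t := by
      intro h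
      filter_upwards [h, hft] with ω h1 h2 hg hf
      exact (Finset.mem_insert.1 (h2 hg hf)).resolve_left (h1 hg hf)
    by_cases hzx : z = x
    · exact ih f hfC hlaw (hskip (Eventually.of_forall fun ω _ h => hzx ▸ h))
    by_cases hB0 : P.real B = 0
    · refine ih f hfC hlaw (hskip ?_)
      have : P B = 0 := (measureReal_eq_zero_iff (measure_ne_top P B)).1 hB0
      filter_upwards [measure_eq_zero_iff_ae_notMem.1 this] with ω hω hg _ hf
      exact hω ⟨hg, hf⟩
    -- Since `{f = x}` and `{g = x}` have equal measure, so do their two differences, and `B` lies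
    -- in one of them. The other thus has room for a set `A` to swap with `B`.
    have hle : P.real B ≤ P.real (f ⁻¹' {x} \ g ⁻¹' {x}) := by
      have h1 := measureReal_inter_add_sdiff (μ := P) (s := f ⁻¹' {x}) (g.measurableSet_preimage {x})
      have h2 := measureReal_inter_add_sdiff (μ := P) (s := g ⁻¹' {x}) (f.measurableSet_preimage {x})
      have h3 : P.real B ≤ P.real (g ⁻¹' {x} \ f ⁻¹' {x}) := by
        refine measureReal_mono fun ω hω => ⟨hω.1, fun h => hzx ?_⟩
        have h4 : f ω = z := hω.2
        have h5 : f ω = x := h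
        rw [← h4, h5]
      rw [Set.inter_comm] at h1
      linarith [hlaw x]
    obtain ⟨A, hAsub, hA, hPA⟩ := hP.exists_subset_measureReal_eq
      ((f.measurableSet_preimage {x}).diff (g.measurableSet_preimage {x})) measureReal_nonneg hle
    have hAB : Disjoint A B := Set.disjoint_left.2 fun ω h1 h2 => (hAsub h1).2 h2.1
    have hfA : ∀ ω ∈ A, f ω = x := fun ω hω => (hAsub hω).1
    have hfB : ∀ ω ∈ B, f ω = z := fun ω hω => hω.2
    let f₁ : SimpleFunc Ω ℝ :=
      .piecewise A hA (.const Ω z) (.piecewise B hBm (.const Ω x) f)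
    have hf₁A : ∀ ω ∈ A, f₁ ω = z := fun ω hω => by simp [f₁, hω]
    have hf₁B : ∀ ω ∈ B, f₁ ω = x := fun ω hω => by
      simp [f₁, hω, Set.disjoint_right.1 hAB hω]
    have hf₁ : ∀ ω, ω ∉ A → ω ∉ B → f₁ ω = f ω := fun ω h1 h2 => by simp [f₁, h1, h2]
    have hf₁C : simpleL1 P f₁ ∈ C := hswap f f₁ A B x z hA hBm hAB hPA hfA hfB
      (fun ω hω => (hf₁A ω hω).trans (by ring)) (fun ω hω => (hf₁B ω hω).trans (by ring))
      hf₁ hfC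
    have hlaw₁ : ∀ v, P.real (f₁ ⁻¹' {v}) = P.real (g ⁻¹' {v}) := fun v =>
      (measureReal_preimage_swap hA hBm hAB hPA hfA hfB hf₁A hf₁B hf₁ v).trans (hlaw v)
    obtain ⟨f', hf'C, hlaw', hf'x, hf's⟩ := ih f₁ hf₁C hlaw₁ (by
      filter_upwards [hft] with ω hω hg hf
      have h1 : ω ∉ A := fun h => (hAsub h).2 hg
      have h2 : ω ∉ B := fun h => hf (hf₁B ω h)
      rw [hf₁ ω h1 h2] at hf ⊢
      exact (Finset.mem_insert.1 (hω hg hf)).resolve_left fun h => h2 ⟨hg, h⟩)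
    refine ⟨f', hf'C, hlaw', hf'x, fun s hs => hf's s ?_⟩
    -- The swap puts `z` on `A`. This creates no new wrong value, because `f` already took the value
    -- `z` wrongly on the non-null set `B`.
    have hzs : z ∈ s := by
      by_contra h
      have : P B = 0 := by
        refine measure_eq_zero_iff_ae_notMem.2 ?_
        filter_upwards [hs] with ω hω hωB
        have h1 : g ω = x := hωB.1
        have h2 : f ω = z := hωB.2
        rw [h1, h2] at hω
        exact h (hω hzx)
      exact hB0 ((measureReal_eq_zero_iff (measure_ne_top P B)).2 this)
    filter_upwards [hs] with ω hω hne
    by_cases h1 : ω ∈ A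
    · rwa [hf₁A ω h1]
    by_cases h2 : ω ∈ B
    · have : g ω = x := h2.1
      exact (hne (by rw [hf₁B ω h2, this])).elim
    rw [hf₁ ω h1 h2] at hne ⊢
    exact hω hne

/-- Induction on the values that `f` takes where it differs from `g`: matching one value removes it
from this list and adds none. -/
theorem simpleL1_mem_of_law_eq_of_mem (hP : Nonatomic P) (hswap : IsStableUnderTransfer C 1)
    (g : SimpleFunc Ω ℝ) (s : Finset ℝ) :
    ∀ f : SimpleFunc Ω ℝ, simpleL1 P f ∈ C →
      (∀ v, P.real (f ⁻¹' {v}) = P.real (g ⁻¹' {v})) →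
      (∀ᵐ ω ∂P, f ω ≠ g ω → f ω ∈ s) → simpleL1 P g ∈ C := by
  induction s using Finset.induction_on with
  | empty =>
    intro f hfC _ hs
    have h : f =ᵐ[P] g := by
      filter_upwards [hs] with ω hω
      by_contra h
      simpa using hω h
    rwa [← simpleL1_congr h]
  | insert x s hx ih =>
    intro f hfC hlaw hs
    obtain ⟨f', hf'C, hlaw', hf'x, hf's⟩ := exists_simpleFunc_match_value hP hswap g x f.range f
      hfC hlaw (Eventually.of_forall fun ω _ _ => f.mem_range_self ω)
    refine ih f' hf'C hlaw' ?_
    have hsub : (g ⁻¹' {x} : Set Ω) ≤ᵐ[P] (f' ⁻¹' {x} : Set Ω) := hf'x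
    -- An a.e. inclusion between sets of equal finite measure is an a.e. equality, so `f'` never
    -- takes the value `x` wrongly.
    have heq : (g ⁻¹' {x} : Set Ω) =ᵐ[P] (f' ⁻¹' {x} : Set Ω) := by
      refine ae_eq_of_ae_subset_of_measure_ge hsub ?_
        (g.measurableSet_preimage _).nullMeasurableSet (measure_ne_top P _)
      exact ((ENNReal.toReal_eq_toReal_iff' (measure_ne_top P _) (measure_ne_top P _)).1
        (hlaw' x)).le
    filter_upwards [heq, hf's _ hs] with ω h1 h2 hne
    have h1 : (g ω = x) = (f' ω = x) := h1
    refine (Finset.mem_insert.1 (h2 hne)).resolve_left fun h => hne ?_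
    rw [h, h1.mpr h]

theorem simpleL1_mem_of_law_eq (hP : Nonatomic P) (hCc : IsClosed C)
    (hC : ∀ X ∈ C, ∀ π : Partition P, condE π X ∈ C) {f g : SimpleFunc Ω ℝ}
    (hf : simpleL1 P f ∈ C) (hlaw : ∀ v, P.real (f ⁻¹' {v}) = P.real (g ⁻¹' {v})) :
    simpleL1 P g ∈ C :=
  simpleL1_mem_of_law_eq_of_mem hP (isStableUnderTransfer_one hP hCc hC) g f.range f hf hlaw
    (Eventually.of_forall fun ω _ => f.mem_range_self ω)

/-- The average over the fibres of a simple function of `X` is a simple function of `X` that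
depends only on the distribution of `X`. -/
theorem exists_condE_eq_comp (s : SimpleFunc ℝ ℝ) (μ : Measure ℝ) :
    ∃ h : SimpleFunc ℝ ℝ, ∀ X : Lp ℝ 1 P, P.map X = μ → ∃ π : Partition P,
      condE π X = simpleL1 P (h.comp X (measurable_coeFn X)) ∧
      condE π (simpleL1 P (s.comp X (measurable_coeFn X))) =
        simpleL1 P (s.comp X (measurable_coeFn X)) := by
  refine ⟨s.map fun v => (∫ x in s ⁻¹' {v}, x ∂μ) / μ.real (s ⁻¹' {v}), fun X hX => ?_⟩
  have hXm := measurable_coeFn X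
  obtain ⟨π, hπ⟩ := exists_partition_fiber (P := P) (s.comp X hXm)
  refine ⟨π, ?_, condE_simpleL1_eq hπ fun ω => ?_⟩
  · refine Lp.ext ((hπ X).trans (EventuallyEq.trans (Eventually.of_forall fun ω => ?_)
      (coeFn_simpleL1 _).symm))
    have hm : MeasurableSet (s ⁻¹' {s (X ω)}) := s.measurableSet_preimage _
    simp only [fiberAverage, SimpleFunc.coe_comp, SimpleFunc.coe_map, Function.comp_apply,
      Set.preimage_comp]
    rw [← hX, setIntegral_map hm (f := fun x : ℝ => x) aestronglyMeasurable_id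
      hXm.aemeasurable, map_measureReal_apply hXm hm]
  · have hc : ∀ x ∈ s.comp X hXm ⁻¹' {s.comp X hXm ω}, s.comp X hXm x = s.comp X hXm ω :=
      fun x hx => hx
    rw [setIntegral_congr_fun ((s.comp X hXm).measurableSet_preimage _) hc, setIntegral_const,
      smul_eq_mul, mul_comm]

/-- A closed subset of `L¹` that is stable under conditional expectations is law-invariant. -/
theorem mem_of_identDistrib (hP : Nonatomic P) (hCc : IsClosed C)
    (hC : ∀ X ∈ C, ∀ π : Partition P, condE π X ∈ C) {X Y : Lp ℝ 1 P} (hX : X ∈ C)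
    (hXY : IdentDistrib (X : Ω → ℝ) (Y : Ω → ℝ) P P) : Y ∈ C := by
  set μ := P.map X with hμ
  have hYμ : P.map Y = μ := hXY.map_eq.symm
  have hμL : MemLp (id : ℝ → ℝ) 1 μ :=
    (memLp_map_measure_iff aestronglyMeasurable_id
      (measurable_coeFn X).aemeasurable).2 (Lp.memLp X)
  rw [← hCc.closure_eq, Metric.mem_closure_iff]
  intro ε hε
  -- One approximation of the identity in `L¹(μ)` discretises `X` and `Y` alike. Conditioning on its
  -- fibres yields `h ∘ X` and `h ∘ Y` with the same `h`, hence with equal laws.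
  obtain ⟨s, hs, -⟩ := hμL.exists_simpleFunc_eLpNorm_sub_lt ENNReal.one_ne_top
    (ε := ENNReal.ofReal (ε / 4)) (by simpa using hε)
  obtain ⟨h, hh⟩ := exists_condE_eq_comp (P := P) s μ
  obtain ⟨π, hπ, -⟩ := hh X rfl
  obtain ⟨π', hπ', hs'⟩ := hh Y hYμ
  refine ⟨condE π' Y, ?_, ?_⟩
  · rw [hπ']
    refine simpleL1_mem_of_law_eq hP hCc hC (hπ ▸ hC X hX π) fun v => ?_
    rw [SimpleFunc.coe_comp, SimpleFunc.coe_comp, Set.preimage_comp, Set.preimage_comp,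
      ← map_measureReal_apply (measurable_coeFn X) (h.measurableSet_preimage _),
      ← map_measureReal_apply (measurable_coeFn Y) (h.measurableSet_preimage _), hYμ]
  · have hn : ‖Y - simpleL1 P (s.comp Y (measurable_coeFn Y))‖ ≤ ε / 4 := by
      rw [Lp.norm_def]
      refine ENNReal.toReal_le_of_le_ofReal (by positivity) (le_trans (le_of_eq ?_) hs.le)
      rw [← hYμ, eLpNorm_map_measure (by fun_prop) (measurable_coeFn Y).aemeasurable]
      refine eLpNorm_congr_ae ?_
      filter_upwards [Lp.coeFn_sub Y (simpleL1 P (s.comp Y (measurable_coeFn Y))),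
        coeFn_simpleL1 (P := P) (s.comp Y (measurable_coeFn Y))] with ω h1 h2
      rw [h1, Pi.sub_apply, h2]
      rfl
    rw [dist_comm, dist_eq_norm]
    linarith [norm_condE_sub_le π' Y hs']

end Law

/-! ### Dominated approximation by conditional expectations -/

section Approximation

variable {Ω : Type*} [MeasurableSpace Ω] {P : Measure Ω} [IsProbabilityMeasure P]

/-- The conditional expectations on finite partitions approximate `X` in `L¹`, even under a bound
`|X| + K`: the tail of `X` is averaged together with a small set on which `X` is bounded. -/
theorem exists_condE_near (hP : Nonatomic P) (X : Lp ℝ 1 P) :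
    ∃ K : ℝ, ∀ ε > 0, ∃ π : Partition P, ‖condE π X - X‖ ≤ ε ∧
      ∀ᵐ ω ∂P, |condE π X ω| ≤ |X ω| + K := by
  have hXm := measurable_coeFn X
  have hXi : Integrable (X : Ω → ℝ) P := L1.integrable_coeFn X
  -- By Markov's inequality this level gives `{|X| < M}` probability at least `1 / 2`, enough room
  -- for the set `B` below.
  set M : ℝ := 2 * ∫ ω, |X ω| ∂P + 1 with hM
  have hI0 : 0 ≤ ∫ ω, |X ω| ∂P := integral_nonneg fun ω => abs_nonneg _
  have hM1 : 1 ≤ M := by linarith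
  set G : Set Ω := {ω | |X ω| < M} with hG
  have hGm : MeasurableSet G := measurableSet_lt hXm.abs measurable_const
  have hPG : 1 / 2 ≤ P.real G := by
    have h1 := mul_meas_ge_le_integral_of_nonneg (μ := P) (f := fun ω => |X ω|)
      (Eventually.of_forall fun ω => abs_nonneg _) hXi.abs M
    have h2 : {ω | M ≤ |X ω|} = Gᶜ := by ext ω; simp [G]
    rw [h2, probReal_compl_eq_one_sub hGm] at h1
    nlinarith
  refine ⟨M + 1, fun ε hε => ?_⟩
  obtain ⟨N, hMN, hN⟩ := exists_setIntegral_tail_lt hXi hXm M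
    (show 0 < min (1 / 2) (ε / (4 * (M + 1))) by positivity)
  set T : Set Ω := {ω | N ≤ |X ω|} with hT
  have hTm : MeasurableSet T := measurableSet_le measurable_const hXm.abs
  set δ : ℝ := ∫ ω in T, |X ω| ∂P with hδ
  have hδ0 : 0 ≤ δ := integral_nonneg fun ω => abs_nonneg _
  have hδ1 : δ ≤ 1 / 2 := (hN.trans_le (min_le_left _ _)).le
  have hδ2 : δ * (4 * (M + 1)) ≤ ε :=
    ((lt_div_iff₀ (by positivity)).1 (hN.trans_le (min_le_right _ _))).le
  -- With `P(B) = δ`, the integral of `|X|` over `T ∪ B` is at most `δ + M * δ ≤ (M + 1) * P(T ∪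
  -- B)`, which bounds the average there by `M + 1`.
  obtain ⟨B, hBG, hB, hPB⟩ := hP.exists_subset_measureReal_eq hGm hδ0 (hδ1.trans hPG)
  have hTB : Disjoint T B := Set.disjoint_left.2 fun ω (h1 : N ≤ |X ω|) h2 => by
    have h3 : |X ω| < M := hBG h2
    linarith
  obtain ⟨k, hk⟩ := exists_nat_gt (max 1 (4 / ε))
  have hk1 : (1 : ℝ) < k := (le_max_left _ _).trans_lt hk
  have hk2 : 1 / (k : ℝ) ≤ ε / 4 := by
    rw [div_le_iff₀ (by linarith)]
    have := (div_lt_iff₀ hε).1 ((le_max_right _ _).trans_lt hk)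
    linarith
  have hk0 : (0 : ℝ) < k := by linarith
  -- Truncation at `N` makes the range finite and has no effect off `T`. There, points of one cell
  -- of mesh `1 / k` have values of `X` differing by at most `1`.
  let q : Ω → ℤ := fun ω => ⌊(k : ℝ) * max (-N) (min N (X ω))⌋
  have hqm : Measurable q := by fun_prop
  have hqfin : (Set.range q).Finite := by
    refine (Set.finite_Icc ⌊(k : ℝ) * (-N)⌋ ⌊(k : ℝ) * N⌋).subset ?_
    rintro _ ⟨ω, rfl⟩
    refine ⟨Int.floor_mono ?_, Int.floor_mono ?_⟩
    · gcongr; exact le_max_left _ _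
    · gcongr; exact max_le (by linarith) (min_le_left _ _)
  let s : SimpleFunc Ω ℤ := ⟨q, fun m => hqm (measurableSet_singleton m), hqfin⟩
  set D : Set Ω := T ∪ B with hD
  have hDm : MeasurableSet D := hTm.union hB
  have hsD : ∀ ω ∉ D, (s ω : ℝ) ≤ k * X ω ∧ k * X ω < s ω + 1 := by
    intro ω hω
    have h1 : |X ω| < N := not_le.1 fun h => hω (Or.inl h)
    have h2 : max (-N) (min N (X ω)) = X ω := by
      rw [min_eq_right (abs_lt.1 h1).2.le, max_eq_right (abs_lt.1 h1).1.le]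
    have h3 : s ω = ⌊(k : ℝ) * X ω⌋ := by
      change ⌊(k : ℝ) * max (-N) (min N (X ω))⌋ = _
      rw [h2]
    rw [h3]
    exact ⟨Int.floor_le _, Int.lt_floor_add_one _⟩
  let g : SimpleFunc Ω (Option ℤ) := .piecewise D hDm (.const Ω none) (s.map some)
  have hg1 : ∀ ω ∈ D, g ω = none := fun ω h => if_pos h
  have hg2 : ∀ ω ∉ D, g ω = some (s ω) := fun ω h => if_neg h
  have hfib1 : ∀ ω ∈ D, g ⁻¹' {g ω} = D := by
    intro ω h
    ext x
    rw [hg1 ω h]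
    by_cases hx : x ∈ D
    · simpa [hx] using hg1 x hx
    · simp [hx, hg2 x hx]
  have hfib2 : ∀ ω ∉ D, ∀ x ∈ g ⁻¹' {g ω}, x ∉ D ∧ s x = s ω := by
    intro ω h x hx
    have hx : g x = g ω := hx
    rw [hg2 ω h] at hx
    by_cases hx' : x ∈ D
    · rw [hg1 x hx'] at hx; cases hx
    · rw [hg2 x hx'] at hx; exact ⟨hx', Option.some.inj hx⟩
  -- A comparison function constant on the fibres of `g`: the error is `|X|` on `D` and at most `1 /
  -- k` elsewhere, and conditioning at most doubles its norm.
  let Z : SimpleFunc Ω ℝ := .piecewise D hDm (.const Ω 0) (s.map fun m : ℤ => (m : ℝ) / k)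
  have hZ1 : ∀ ω ∈ D, Z ω = 0 := fun ω h => if_pos h
  have hZ2 : ∀ ω ∉ D, Z ω = s ω / k := fun ω h => if_neg h
  have hXB : ∫ ω in B, |X ω| ∂P ≤ M * δ := by
    have h1 : ∫ ω in B, |X ω| ∂P ≤ ∫ _ in B, M ∂P :=
      setIntegral_mono_on hXi.abs.integrableOn (integrable_const M).integrableOn hB
        fun ω hω => (show |X ω| < M from hBG hω).le
    rwa [setIntegral_const, hPB, smul_eq_mul, mul_comm] at h1
  have hXD : ∫ ω in D, |X ω| ∂P ≤ (M + 1) * δ := by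
    rw [setIntegral_union hTB hB hXi.abs.integrableOn hXi.abs.integrableOn]
    linarith
  obtain ⟨π, hπ⟩ := exists_partition_fiber (P := P) g
  refine ⟨π, ?_, ?_⟩
  · have hZπ : condE π (simpleL1 P Z) = simpleL1 P Z := by
      refine condE_simpleL1_eq hπ fun ω => ?_
      have hc : ∀ x ∈ g ⁻¹' {g ω}, Z x = Z ω := by
        intro x hx
        by_cases h : ω ∈ D
        · rw [hfib1 ω h] at hx
          rw [hZ1 x hx, hZ1 ω h]
        · obtain ⟨h1, h2⟩ := hfib2 ω h x hx
          rw [hZ2 x h1, hZ2 ω h, h2]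
      rw [setIntegral_congr_fun (g.measurableSet_preimage _) hc, setIntegral_const,
        smul_eq_mul, mul_comm]
    have hXZ : ‖X - simpleL1 P Z‖ ≤ (M + 1) * δ + 1 / k := by
      rw [L1.norm_eq_integral_norm]
      calc ∫ ω, ‖(X - simpleL1 P Z : Lp ℝ 1 P) ω‖ ∂P
          ≤ ∫ ω, (D.indicator (fun ω => |X ω|) ω + 1 / k) ∂P := by
            refine integral_mono_ae (L1.integrable_coeFn _).norm
              ((hXi.abs.indicator hDm).add (integrable_const _)) ?_
            filter_upwards [Lp.coeFn_sub X (simpleL1 P Z), coeFn_simpleL1 (P := P) Z]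
              with ω h1 h2
            rw [h1, Pi.sub_apply, h2, Real.norm_eq_abs]
            by_cases h : ω ∈ D
            · rw [hZ1 ω h, sub_zero, Set.indicator_of_mem h]
              linarith [show 0 < 1 / (k : ℝ) by positivity]
            · rw [hZ2 ω h, Set.indicator_of_notMem h, zero_add]
              obtain ⟨h3, h4⟩ := hsD ω h
              have h5 : X ω - s ω / k = (k * X ω - s ω) / k := by field_simp
              rw [h5, abs_of_nonneg (div_nonneg (by linarith) hk0.le)]
              gcongr
              linarith
        _ = ∫ ω in D, |X ω| ∂P + 1 / k := by
            rw [integral_add (hXi.abs.indicator hDm) (integrable_const _),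
              integral_indicator hDm]
            simp
        _ ≤ _ := by linarith
    refine (norm_condE_sub_le π X hZπ).trans ?_
    linarith
  · filter_upwards [hπ X] with ω hω
    rw [hω, fiberAverage, abs_div, abs_of_nonneg (measureReal_nonneg (μ := P))]
    by_cases h : ω ∈ D
    · rw [hfib1 ω h]
      have h1 : |∫ x in D, X x ∂P| ≤ (M + 1) * P.real D := by
        refine abs_integral_le_integral_abs.trans (hXD.trans ?_)
        rw [← hPB]
        exact mul_le_mul_of_nonneg_left (measureReal_mono Set.subset_union_right) (by linarith)
      have h2 := div_le_of_le_mul₀ (measureReal_nonneg (μ := P)) (by linarith) h1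
      linarith [abs_nonneg (X ω)]
    · refine div_le_of_le_mul₀ measureReal_nonneg (by positivity) ?_
      rw [← Real.norm_eq_abs]
      refine norm_setIntegral_le_of_norm_le_const (measure_lt_top P _) fun x hx => ?_
      obtain ⟨h1, h2⟩ := hfib2 ω h x hx
      obtain ⟨h3, h4⟩ := hsD ω h
      obtain ⟨h5, h6⟩ := hsD x h1
      rw [h2] at h5 h6
      have h7 : |X x - X ω| ≤ 1 := by
        rw [abs_le]
        constructor <;> nlinarith
      rw [Real.norm_eq_abs]
      have h8 := abs_add_le (X x - X ω) (X ω)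
      rw [sub_add_cancel] at h8
      linarith

end Approximation

/-! ### The weak topology and finitely many averages -/

section WeakTopology

variable {Ω : Type*} [MeasurableSpace Ω] {P : Measure Ω}

theorem continuous_integral_mul_of_mem_simpleRV {Y : Lp ℝ 1 P} (hY : Y ∈ simpleRV P) :
    Continuous fun X : Lp ℝ 1 P => ∫ ω, X ω * Y ω ∂P := by
  obtain ⟨s, hs⟩ := hY
  have hYs : Y =ᵐ[P] s := by
    rw [← hs]
    exact AEEqFun.coeFn_mk _ _
  obtain ⟨M, hM⟩ := s.exists_forall_norm_le
  have hint : ∀ X : Lp ℝ 1 P, Integrable (fun ω => X ω * s ω) P := fun X =>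
    (L1.integrable_coeFn X).mul_bdd (c := M) s.aestronglyMeasurable (Eventually.of_forall hM)
  have heq : ∀ X : Lp ℝ 1 P, ∫ ω, X ω * Y ω ∂P = ∫ ω, X ω * s ω ∂P := fun X =>
    integral_congr_ae (by filter_upwards [hYs] with ω hω; rw [hω])
  simp_rw [heq]
  refine (LipschitzWith.of_dist_le_mul (K := M.toNNReal) fun X Z => ?_).continuous
  rw [dist_eq_norm, dist_eq_norm, ← integral_sub (hint X) (hint Z), L1.norm_eq_integral_norm,
    ← integral_const_mul]
  refine norm_integral_le_of_norm_le ((L1.integrable_coeFn _).norm.const_mul _) ?_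
  filter_upwards [Lp.coeFn_sub X Z] with ω hω
  rw [hω, Pi.sub_apply, ← sub_mul, norm_mul, mul_comm]
  gcongr
  exact (hM ω).trans (Real.le_coe_toNNReal M)

/-- Simple random variables are bounded, so the weak topology is coarser than the norm topology. -/
theorem isClosed_of_isClosed_weakTopology {C : Set (Lp ℝ 1 P)}
    (hC : IsClosed[weakTopology P] C) : IsClosed C :=
  hC.mono <| le_iInf fun Y =>
    continuous_iff_le_induced.1 (continuous_integral_mul_of_mem_simpleRV Y.2)

variable [IsProbabilityMeasure P]

theorem continuous_weakTopology_setIntegral {A : Set Ω} (hA : MeasurableSet A) :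
    Continuous[weakTopology P, inferInstance] fun X : Lp ℝ 1 P => ∫ ω in A, X ω ∂P := by
  let Y : SimpleFunc Ω ℝ := .piecewise A hA (.const Ω 1) (.const Ω 0)
  have h : (fun X : Lp ℝ 1 P => ∫ ω in A, X ω ∂P) =
      fun X : Lp ℝ 1 P => ∫ ω, X ω * simpleL1 P Y ω ∂P := by
    funext X
    rw [← integral_indicator hA]
    refine integral_congr_ae ?_
    filter_upwards [coeFn_simpleL1 (P := P) Y] with ω hω
    rw [hω]
    by_cases h : ω ∈ A <;> simp [Y, h]
  rw [h]
  exact continuous_iInf_dom (i := (⟨simpleL1 P Y, simpleL1_mem_simpleRV Y⟩ : simpleRV P))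
    continuous_induced_dom

/-- The averages of `X` over the members of a partition. -/
noncomputable def Partition.averages (π : Partition P) (X : Lp ℝ 1 P) (A : π.parts) : ℝ :=
  (∫ ω in (A : Set Ω), X ω ∂P) / P.real A

theorem Partition.continuous_averages (π : Partition P) :
    Continuous[weakTopology P, inferInstance] π.averages :=
  (@continuous_pi_iff _ _ _ (weakTopology P) _ _).2 fun A =>
    @Continuous.comp _ _ _ (weakTopology P) _ _ _ _ (continuous_id.div_const _)
      (continuous_weakTopology_setIntegral (π.measurableSet A A.2))

theorem Partition.condE_ae_eq_averages (π : Partition P) (X : Lp ℝ 1 P) :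
    ∀ᵐ ω ∂P, ∀ A : π.parts, ω ∈ (A : Set Ω) → condE π X ω = π.averages X A := by
  filter_upwards [condE_ae_eq π X] with ω h A hω
  rw [h, π.condExp_apply (L1.integrable_coeFn X) A.2 hω, Partition.averages]

end WeakTopology

/-! ### Consequences of the Fatou property -/

section Fatou

variable {Ω : Type*} [MeasurableSpace Ω] {P : Measure Ω}
  {𝒳 : Set (Lp ℝ 1 P)} {ρ : Lp ℝ 1 P → EReal}

/-- The Fatou property applies to sequences with a common bound in the ideal. -/
theorem HasFatouPropertyOn.le_liminf (hF : HasFatouPropertyOn 𝒳 ρ) {X : ℕ → Lp ℝ 1 P}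
    {Z W : Lp ℝ 1 P} (hX : ∀ n, X n ∈ 𝒳) (hZ : Z ∈ 𝒳)
    (hlim : ∀ᵐ ω ∂P, Tendsto (fun n => X n ω) atTop (𝓝 (Z ω))) (hW : W ∈ solidSpan 𝒳)
    (hXW : ∀ n, ∀ᵐ ω ∂P, |X n ω| ≤ W ω) : ρ Z ≤ liminf (fun n => ρ (X n)) atTop := by
  refine hF X Z hX hZ hlim ?_
  let S : Ω → ℝ := fun ω => ⨆ n, |X n ω|
  have hSm : Measurable S := Measurable.iSup fun n => (measurable_coeFn (X n)).abs
  have hbound : ∀ᵐ ω ∂P, ∀ n, |X n ω| ≤ W ω := ae_all_iff.2 hXW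
  have hlub : ∀ᵐ ω ∂P, IsLUB (Set.range fun n => |X n ω|) (S ω) := by
    filter_upwards [hbound] with ω hω
    exact isLUB_ciSup ⟨W ω, by rintro _ ⟨n, rfl⟩; exact hω n⟩
  have hSabs : ∀ᵐ ω ∂P, |S ω| ≤ W ω := by
    filter_upwards [hbound, hlub] with ω h1 h2
    rw [abs_of_nonneg ((abs_nonneg _).trans (h2.1 ⟨0, rfl⟩))]
    exact h2.2 (by rintro _ ⟨n, rfl⟩; exact h1 n)
  have hSi : Integrable S P :=
    (L1.integrable_coeFn W).mono' hSm.aestronglyMeasurable hSabs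
  refine ⟨hSi.toL1 S, Submodule.mem_sInf.2 fun I hI => ?_, ?_⟩
  · refine hI.2 _ W ?_ (Submodule.mem_sInf.1 hW I hI)
    rw [← Lp.coeFn_le]
    filter_upwards [hSi.coeFn_toL1, hSabs, Lp.coeFn_abs (hSi.toL1 S), Lp.coeFn_abs W]
      with ω h1 h2 h3 h4
    rw [h3, h4, h1]
    exact h2.trans (le_abs_self _)
  · filter_upwards [hSi.coeFn_toL1, hlub] with ω h1 h2
    rwa [h1]

variable [IsProbabilityMeasure P]

theorem const_mem_simpleRV (c : ℝ) : Lp.const 1 P c ∈ simpleRV P := by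
  have h : Lp.const 1 P c = simpleL1 P (SimpleFunc.const Ω c) :=
    Lp.ext ((Lp.coeFn_const (p := 1) (μ := P) c).trans
      (coeFn_simpleL1 (P := P) (SimpleFunc.const Ω c)).symm)
  exact h ▸ simpleL1_mem_simpleRV _

theorem abs_add_const_mem_solidSpan (h𝒳 : simpleRV P ⊆ 𝒳) {X : Lp ℝ 1 P} (hX : X ∈ 𝒳) (c : ℝ) :
    |X| + Lp.const 1 P c ∈ solidSpan 𝒳 := by
  refine Submodule.mem_sInf.2 fun I hI => I.add_mem ?_ (hI.1 (h𝒳 (const_mem_simpleRV c)))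
  exact hI.2 |X| X (abs_abs X).le (hI.1 hX)

theorem const_mem_solidSpan (h𝒳 : simpleRV P ⊆ 𝒳) (c : ℝ) :
    Lp.const 1 P c ∈ solidSpan 𝒳 :=
  Submodule.mem_sInf.2 fun _ hI => hI.1 (h𝒳 (const_mem_simpleRV c))

/-- On the finite-dimensional space of `π`-measurable random variables, the Fatou property is
lower semicontinuity. -/
theorem isClosed_weakTopology_setOf_condE_le (h𝒳 : simpleRV P ⊆ 𝒳)
    (hF : HasFatouPropertyOn 𝒳 ρ) (π : Partition P) (c : EReal) :
    IsClosed[weakTopology P] {X : Lp ℝ 1 P | ρ (condE π X) ≤ c} := by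
  set K : Set (Lp ℝ 1 P) := {X | ρ (condE π X) ≤ c} with hK
  -- Closedness reduces to a finite-dimensional, hence metrizable, space, where sequences suffice.
  -- Convergence of the averages gives a.s. convergence of the conditional expectations under a
  -- constant bound.
  have hKeq : K = π.averages ⁻¹' closure (π.averages '' K) := by
    refine Set.Subset.antisymm (fun X hX => subset_closure ⟨X, hX, rfl⟩) fun X hX => ?_
    obtain ⟨v, hv, hlim⟩ := mem_closure_iff_seq_limit.1 hX
    choose Y hYK hYv using hv
    obtain ⟨M, hM⟩ := hlim.norm.bddAbove_range
    have hle : ρ (condE π X) ≤ liminf (fun n => ρ (condE π (Y n))) atTop := by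
      refine hF.le_liminf (fun n => h𝒳 (condE_mem_simpleRV π (Y n)))
        (h𝒳 (condE_mem_simpleRV π X)) ?_ (const_mem_solidSpan h𝒳 M) fun n => ?_
      · filter_upwards [π.condE_ae_eq_averages X,
          ae_all_iff.2 fun n => π.condE_ae_eq_averages (Y n)] with ω h1 h2
        obtain ⟨A, hA, hω⟩ := π.exists_mem ω
        simp_rw [h1 ⟨A, hA⟩ hω, fun n => h2 n ⟨A, hA⟩ hω, hYv]
        exact tendsto_pi_nhds.1 hlim _
      · filter_upwards [π.condE_ae_eq_averages (Y n), Lp.coeFn_const (p := 1) (μ := P) M]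
          with ω h1 h2
        obtain ⟨A, hA, hω⟩ := π.exists_mem ω
        rw [h1 ⟨A, hA⟩ hω, h2, hYv, Function.const_apply]
        exact (norm_le_pi_norm (v n) _).trans (hM ⟨n, rfl⟩)
    refine hle.trans ?_
    calc liminf (fun n => ρ (condE π (Y n))) atTop ≤ liminf (fun _ : ℕ => c) atTop :=
          liminf_le_liminf (Eventually.of_forall hYK)
      _ = c := liminf_const c
  rw [hKeq]
  exact @IsClosed.preimage _ _ (weakTopology P) _ _ π.continuous_averages _ isClosed_closure

theorem isLSC_extension (h𝒳 : simpleRV P ⊆ 𝒳) (hF : HasFatouPropertyOn 𝒳 ρ) :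
    IsLSC (weakTopology P) (extension ρ) := by
  intro c
  simp only [extension, iSup_le_iff, Set.ofPred_forall]
  exact @isClosed_iInter _ _ (weakTopology P) _ fun π =>
    isClosed_weakTopology_setOf_condE_le h𝒳 hF π c

theorem le_extension (hP : Nonatomic P) (h𝒳 : simpleRV P ⊆ 𝒳) (hF : HasFatouPropertyOn 𝒳 ρ)
    {X : Lp ℝ 1 P} (hX : X ∈ 𝒳) : ρ X ≤ extension ρ X := by
  obtain ⟨K, hK⟩ := exists_condE_near hP X
  choose π hπ hπK using fun n : ℕ => hK (1 / ((n : ℝ) + 1)) (by positivity)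
  have hlim : Tendsto (fun n => condE (π n) X) atTop (𝓝 X) := by
    rw [tendsto_iff_norm_sub_tendsto_zero]
    exact squeeze_zero (fun n => norm_nonneg _) hπ tendsto_one_div_add_atTop_nhds_zero_nat
  -- Norm convergence gives a.s. convergence only along a subsequence, which is enough since every
  -- term is bounded by `extension ρ X`.
  obtain ⟨φ, -, hφ⟩ := (tendstoInMeasure_of_tendsto_Lp hlim).exists_seq_tendsto_ae
  calc ρ X ≤ liminf (fun n => ρ (condE (π (φ n)) X)) atTop := by
        refine hF.le_liminf (fun n => h𝒳 (condE_mem_simpleRV _ X)) hX hφ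
          (abs_add_const_mem_solidSpan h𝒳 hX K) fun n => ?_
        filter_upwards [hπK (φ n), Lp.coeFn_add |X| (Lp.const 1 P K), Lp.coeFn_abs X,
          Lp.coeFn_const (p := 1) (μ := P) K] with ω h1 h2 h3 h4
        rwa [h2, Pi.add_apply, h3, h4]
    _ ≤ liminf (fun _ : ℕ => extension ρ X) atTop :=
        liminf_le_liminf (Eventually.of_forall fun n => le_iSup (fun π => ρ (condE π X)) _)
    _ = extension ρ X := liminf_const _

end Fatou

/-! ### Inherited properties, law-invariance and uniqueness -/

section Extension

variable {Ω : Type*} [MeasurableSpace Ω] {P : Measure Ω}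
  {𝒳 : Set (Lp ℝ 1 P)} {ρ : Lp ℝ 1 P → EReal}

theorem condE_le_extension (π : Partition P) (X : Lp ℝ 1 P) :
    ρ (condE π X) ≤ extension ρ X :=
  le_iSup (fun π => ρ (condE π X)) π

theorem isMonotoneOn_extension (h𝒳 : simpleRV P ⊆ 𝒳) (h : IsMonotoneOn 𝒳 ρ) :
    IsMonotoneOn Set.univ (extension ρ) := fun X _ Y _ hXY =>
  iSup_le fun π => (h _ (h𝒳 (condE_mem_simpleRV π X)) _ (h𝒳 (condE_mem_simpleRV π Y))
    (condE_mono π hXY)).trans (condE_le_extension π Y)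

theorem isConvexOn_extension (h𝒳 : simpleRV P ⊆ 𝒳) (h : IsConvexOn 𝒳 ρ) :
    IsConvexOn Set.univ (extension ρ) := by
  intro X _ Y _ t ht0 ht1 _
  refine iSup_le fun π => ?_
  have hmem := h𝒳 (condE_mem_simpleRV π (t • X + (1 - t) • Y))
  rw [condE_add, condE_smul, condE_smul] at hmem ⊢
  refine (h _ (h𝒳 (condE_mem_simpleRV π X)) _ (h𝒳 (condE_mem_simpleRV π Y)) t ht0 ht1
    hmem).trans (add_le_add ?_ ?_)
  · exact mul_le_mul_of_nonneg_left (condE_le_extension π X) (EReal.coe_nonneg.2 ht0.le)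
  · exact mul_le_mul_of_nonneg_left (condE_le_extension π Y)
      (EReal.coe_nonneg.2 (sub_nonneg.2 ht1.le))

theorem isQuasiconvexOn_extension (h𝒳 : simpleRV P ⊆ 𝒳) (h : IsQuasiconvexOn 𝒳 ρ) :
    IsQuasiconvexOn Set.univ (extension ρ) := by
  intro X _ Y _ t ht0 ht1 _
  refine iSup_le fun π => ?_
  have hmem := h𝒳 (condE_mem_simpleRV π (t • X + (1 - t) • Y))
  rw [condE_add, condE_smul, condE_smul] at hmem ⊢
  exact (h _ (h𝒳 (condE_mem_simpleRV π X)) _ (h𝒳 (condE_mem_simpleRV π Y)) t ht0 ht1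
    hmem).trans (max_le_max (condE_le_extension π X) (condE_le_extension π Y))

variable [IsProbabilityMeasure P]

theorem isCashAdditiveOn_extension (h𝒳 : simpleRV P ⊆ 𝒳) (h : IsCashAdditiveOn 𝒳 ρ) :
    IsCashAdditiveOn Set.univ (extension ρ) := by
  have hle : ∀ (X : Lp ℝ 1 P) (s : ℝ),
      extension ρ (X + Lp.const 1 P s) ≤ extension ρ X - (s : EReal) := by
    intro X s
    refine iSup_le fun π => ?_
    have hmem := h𝒳 (condE_mem_simpleRV π (X + Lp.const 1 P s))
    rw [condE_add, condE_const] at hmem ⊢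
    rw [h _ (h𝒳 (condE_mem_simpleRV π X)) s hmem]
    exact EReal.sub_le_sub (condE_le_extension π X) le_rfl
  intro X _ s _
  refine (hle X s).antisymm ?_
  -- The reverse inequality is the one already proved, applied to the shift back by `-s`.
  have h1 := hle (X + Lp.const 1 P s) (-s)
  rw [add_assoc, ← map_add, add_neg_cancel, map_zero, add_zero, EReal.coe_neg,
    sub_eq_add_neg, neg_neg] at h1
  exact EReal.sub_le_of_le_add h1

theorem isProperOn_extension (h𝒳 : simpleRV P ⊆ 𝒳) (h : IsProperOn 𝒳 ρ) :
    IsProperOn Set.univ (extension ρ) := by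
  intro X _ hX
  -- Some partition must exist, since a supremum over the empty family would be `⊥`.
  obtain ⟨π, -⟩ := exists_partition_fiber (P := P) (SimpleFunc.const Ω (0 : ℝ))
  exact h _ (h𝒳 (condE_mem_simpleRV π X)) (le_bot_iff.1 (hX ▸ condE_le_extension π X))

theorem eqOn_extension (hP : Nonatomic P) (h𝒳 : simpleRV P ⊆ 𝒳)
    (hdil : IsDilatationMonotoneOn 𝒳 ρ) (hF : HasFatouPropertyOn 𝒳 ρ) :
    Set.EqOn (extension ρ) ρ 𝒳 := fun X hX =>
  (iSup_le fun π => hdil X hX π).antisymm (le_extension hP h𝒳 hF hX)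

theorem isDilatationMonotoneOn_extension (hP : Nonatomic P) (h𝒳 : simpleRV P ⊆ 𝒳)
    (hdil : IsDilatationMonotoneOn 𝒳 ρ) (hF : HasFatouPropertyOn 𝒳 ρ) :
    IsDilatationMonotoneOn Set.univ (extension ρ) := fun X _ π => by
  rw [eqOn_extension hP h𝒳 hdil hF (h𝒳 (condE_mem_simpleRV π X))]
  exact condE_le_extension π X

/-- Sublevel sets are norm closed and, by dilatation monotonicity, stable under conditioning, so
they contain `Y` whenever they contain an `X` of the same law. -/
theorem isLawInvariantOn_of_isLSC (hP : Nonatomic P) (hdil : IsDilatationMonotoneOn Set.univ ρ)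
    (hlsc : IsLSC (weakTopology P) ρ) : IsLawInvariantOn Set.univ ρ := by
  have hle : ∀ X Y : Lp ℝ 1 P, IdentDistrib (X : Ω → ℝ) (Y : Ω → ℝ) P P → ρ Y ≤ ρ X := by
    intro X Y hXY
    by_contra! hlt
    obtain ⟨c, hXc, hcY⟩ := EReal.lt_iff_exists_real_btwn.1 hlt
    have : Y ∈ {Z : Lp ℝ 1 P | ρ Z ≤ c} :=
      mem_of_identDistrib hP (isClosed_of_isClosed_weakTopology (hlsc c))
        (fun Z hZ π => (hdil Z (Set.mem_univ Z) π).trans hZ) hXc.le hXY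
    exact (hcY.trans_le this).false
  exact fun X _ Y _ hXY => (hle Y X hXY.symm).antisymm (hle X Y hXY)

/-- If `ρ'` exceeded the supremum at `X`, a real level strictly between would give a norm closed
sublevel set containing all `condE π X` but not their limit point `X`. -/
theorem eq_extension (hP : Nonatomic P) (h𝒳 : simpleRV P ⊆ 𝒳) {ρ' : Lp ℝ 1 P → EReal}
    (heq : Set.EqOn ρ' ρ 𝒳) (hdil : IsDilatationMonotoneOn Set.univ ρ')
    (hlsc : IsLSC (weakTopology P) ρ') : ρ' = extension ρ := by
  have hcond : ∀ (π : Partition P) (X : Lp ℝ 1 P), ρ' (condE π X) = ρ (condE π X) :=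
    fun π X => heq (h𝒳 (condE_mem_simpleRV π X))
  funext X
  refine le_antisymm ?_ (iSup_le fun π => hcond π X ▸ hdil X (Set.mem_univ X) π)
  by_contra! hlt
  obtain ⟨c, hXc, hcX⟩ := EReal.lt_iff_exists_real_btwn.1 hlt
  have hcl := isClosed_of_isClosed_weakTopology (hlsc c)
  have : X ∈ {Z : Lp ℝ 1 P | ρ' Z ≤ c} := by
    rw [← hcl.closure_eq, Metric.mem_closure_iff]
    intro ε hε
    obtain ⟨K, hK⟩ := exists_condE_near hP X
    obtain ⟨π, hπ, -⟩ := hK (ε / 2) (by positivity)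
    refine ⟨condE π X, ?_, ?_⟩
    · exact (hcond π X).le.trans ((condE_le_extension π X).trans hXc.le)
    · rw [dist_comm, dist_eq_norm]
      linarith
  exact (hcX.trans_le this).false

end Extension

end DilatationMonotone

open DilatationMonotone in
theorem mainTheorem1 {Ω : Type*} [MeasurableSpace Ω] (P : Measure Ω) [IsProbabilityMeasure P]
    (hP : Nonatomic P) (𝒳 : Set (Lp ℝ 1 P)) (h𝒳 : simpleRV P ⊆ 𝒳)
    (ρ : Lp ℝ 1 P → EReal) (hproper : IsProperOn 𝒳 ρ)
    (hdil : IsDilatationMonotoneOn 𝒳 ρ) (hFatou : HasFatouPropertyOn 𝒳 ρ) :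
    -- the functional defined by the supremum is an extension with the stated properties
    (IsProperOn Set.univ (extension ρ) ∧
      Set.EqOn (extension ρ) ρ 𝒳 ∧
      IsDilatationMonotoneOn Set.univ (extension ρ) ∧
      IsLSC (weakTopology P) (extension ρ)) ∧
    -- it is the only such extension
    (∀ ρ' : Lp ℝ 1 P → EReal, Set.EqOn ρ' ρ 𝒳 → IsDilatationMonotoneOn Set.univ ρ' →
      IsLSC (weakTopology P) ρ' → ρ' = extension ρ) ∧
    -- law-invariance and preservation of properties
    IsLawInvariantOn Set.univ (extension ρ) ∧
    (IsMonotoneOn 𝒳 ρ → IsMonotoneOn Set.univ (extension ρ)) ∧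
    (IsConvexOn 𝒳 ρ → IsConvexOn Set.univ (extension ρ)) ∧
    (IsQuasiconvexOn 𝒳 ρ → IsQuasiconvexOn Set.univ (extension ρ)) ∧
    (IsCashAdditiveOn 𝒳 ρ → IsCashAdditiveOn Set.univ (extension ρ)) := by
  have hdil' := isDilatationMonotoneOn_extension hP h𝒳 hdil hFatou
  have hlsc := isLSC_extension h𝒳 hFatou
  exact ⟨⟨isProperOn_extension h𝒳 hproper, eqOn_extension hP h𝒳 hdil hFatou, hdil', hlsc⟩,
    fun ρ' heq hd hl => eq_extension hP h𝒳 heq hd hl,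
    isLawInvariantOn_of_isLSC hP hdil' hlsc,
    isMonotoneOn_extension h𝒳, isConvexOn_extension h𝒳, isQuasiconvexOn_extension h𝒳,
    isCashAdditiveOn_extension h𝒳⟩
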